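/- **Theorem (generalized Takahashi theorem).** Let $\mathbb K=\mathbb R$ or $\mathbb C$, let $W$ be a finite-dimensional $\mathbb K$-vector space with an inner product (Hermitian if $\mathbb K=\mathbb C$), and let $Gr_p(W)$ be the Grassmannian of oriented $p$-dimensional subspaces of $W$ (if $\mathbb K=\mathbb R$), respectively of $p$-dimensional complex subspaces (if $\mathbb K=\mathbb C$). Let $S\subset \underline W$ be its tautological bundle and $Q=\underline W/S\cong S^\perp$ its quotient bundle, of rank $q=\dim_{\mathbb K} W-p$. Give $Gr_p(W)$ the Riemannian metric $g_{Gr}(X,Y)=\operatorname{Re}\operatorname{tr}(X^*Y)$ for $X,Y\in T_PGr_p(W)=\operatorname{Hom}_{\mathbb K}(S_P,Q_P)$. Let $(M,g)$ be an $n$-dimensional smooth Riemannian manifold and $f:M\to Gr_p(W)$ a smooth map. Put $U=f^*S$ and $V=f^*Q=U^\perp$, regarded as subbundles of $M\times W$ with orthogonal projections $\pi_U,\pi_V$. On $V$ take the connection $\nabla^V t=\pi_V(dt)$ and the Laplacian $\Delta=-\operatorname{trace}\nabla\nabla^V$ (formed with the Levi-Civita connection of $g$). Let $H_Xs=\pi_V(ds(X))$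 for $s\in\Gamma(U)$ and $K_Xt=\pi_U(dt(X))$ for $t\in\Gamma(V)$ be the second fundamental forms, and let $A=\sum_{i=1}^nH_{e_i}K_{e_i}\in\Gamma(\operatorname{End}V)$, with $e_1,\dots,e_n$ an orthonormal basis of the tangent space, be the mean curvature operator of $f$. Every $w\in W$ is regarded as the section $t=\pi_V(w)$ of $V$. Let $e(f)=|df|^2=\sum_i|df(e_i)|^2$ be the energy density; $f$ is harmonic if its tension field $\tau(f)=\operatorname{trace}\nabla df$ vanishes identically. Then the following two conditions are equivalent. 1. $f$ is harmonic and there is a function $h:M\to\mathbb R$ with $A_x=-h(x)\,\mathrm{Id}_{V_x}$ for all $x\in M$. 2. There is a function $h:M\to\mathbb R$ with $\Delta t=h\,t$ for every $t\in W$. More precisely, for every function $h:M\to\mathbb K$, $f$ is harmonic with $A=-h\,\mathrm{Id}_V$ if and only if $\Delta t=h\,t$ for every $t\in W$; and in that case $e(f)=q\,h$. In particular, if moreover $f$ is an isometric immersion (so that harmonic means minimal), then $n=q\,h$. -/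

import Mathlib

open Bundle
open scoped Manifold ContDiff

noncomputable section

namespace Grassmann

section Points

variable (𝕜 : Type*) [RCLike 𝕜] (W : Type*) [NormedAddCommGroup W] [InnerProductSpace 𝕜 W]

/-- `𝕜ᵖ` with its standard scalar product. -/
abbrev Coord (p : ℕ) : Type _ := EuclideanSpace 𝕜 (Fin p)

/-- A `p`-frame of `W`, that is `p` linearly independent vectors of `W`, written as the injective
linear map `𝕜ᵖ → W` which sends the standard basis to them. -/
abbrev Frame (p : ℕ) : Type _ := {v : Coord 𝕜 p →L[𝕜] W // Function.Injective v}

variable {𝕜 W}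

/-- The determinants of the admissible changes of frame: positive numbers if `𝕜 = ℝ` (this is the
case `RCLike.I = 0`), and all non-zero numbers if `𝕜 = ℂ`. -/
def Admissible (z : 𝕜) : Prop := z ≠ 0 ∧ ((RCLike.I : 𝕜) = 0 → 0 < RCLike.re z)

theorem Admissible.one : Admissible (1 : 𝕜) := ⟨one_ne_zero, fun _ => by simp⟩

theorem Admissible.mul {a b : 𝕜} (ha : Admissible a) (hb : Admissible b) :
    Admissible (a * b) := by
  refine ⟨mul_ne_zero ha.1 hb.1, fun h => ?_⟩
  rw [RCLike.mul_re, RCLike.im_eq_zero h a]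
  simpa using mul_pos (ha.2 h) (hb.2 h)

theorem Admissible.inv {a : 𝕜} (ha : Admissible a) : Admissible a⁻¹ := by
  refine ⟨inv_ne_zero ha.1, fun h => ?_⟩
  rw [RCLike.inv_re]
  exact div_pos (ha.2 h) (RCLike.normSq_pos.2 ha.1)

theorem Admissible.isOpen : IsOpen {z : 𝕜 | Admissible z} := by
  by_cases h : (RCLike.I : 𝕜) = 0
  · simp only [Admissible, h, forall_const]
    exact isOpen_ne.inter (isOpen_lt continuous_const RCLike.continuous_re)
  · simp only [Admissible, h, false_imp_iff, and_true]
    exact isOpen_ne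

variable (𝕜 W)

/-- Two frames are equivalent if they differ by an admissible change of frame: in the real case
they span the same subspace and induce the same orientation on it, in the complex case they span
the same subspace. -/
def frameSetoid (p : ℕ) : Setoid (Frame 𝕜 W p) where
  r v w := ∃ g : Coord 𝕜 p ≃L[𝕜] Coord 𝕜 p,
    Admissible (LinearMap.det (g : Coord 𝕜 p →ₗ[𝕜] Coord 𝕜 p)) ∧ w.1 = v.1 ∘L g
  iseqv :=
    { refl := fun v => ⟨.refl 𝕜 _, by
        have : ((ContinuousLinearEquiv.refl 𝕜 (Coord 𝕜 p) : Coord 𝕜 p ≃L[𝕜] Coord 𝕜 p) :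
          Coord 𝕜 p →ₗ[𝕜] Coord 𝕜 p) = LinearMap.id := rfl
        rw [this, LinearMap.det_id]; exact Admissible.one, rfl⟩
      symm := by
        rintro v w ⟨g, hg, h⟩
        refine ⟨g.symm, ?_, ?_⟩
        · have h1 : LinearMap.det (g.symm : Coord 𝕜 p →ₗ[𝕜] Coord 𝕜 p) *
              LinearMap.det (g : Coord 𝕜 p →ₗ[𝕜] Coord 𝕜 p) = 1 := by
            rw [← LinearMap.det_comp]
            convert LinearMap.det_id
            ext1 x; simp
          rw [eq_inv_of_mul_eq_one_left h1]
          exact hg.inv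
        · rw [h]; ext1 x; simp
      trans := by
        rintro u v w ⟨g, hg, h⟩ ⟨g', hg', h'⟩
        refine ⟨g'.trans g, ?_, ?_⟩
        · have : ((g'.trans g : Coord 𝕜 p ≃L[𝕜] Coord 𝕜 p) : Coord 𝕜 p →ₗ[𝕜] Coord 𝕜 p) =
            (g : Coord 𝕜 p →ₗ[𝕜] Coord 𝕜 p) ∘ₗ (g' : Coord 𝕜 p →ₗ[𝕜] Coord 𝕜 p) := rfl
          rw [this, LinearMap.det_comp]
          exact hg.mul hg'
        · rw [h', h]; rfl }

/-- The Grassmannian `Gr_p(W)`: oriented `p`-dimensional subspaces of `W` if `𝕜 = ℝ`, and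
`p`-dimensional complex subspaces if `𝕜 = ℂ`, with the quotient topology from the space of
frames. -/
def Gr (p : ℕ) : Type _ := Quotient (frameSetoid 𝕜 W p)

instance (p : ℕ) : TopologicalSpace (Gr 𝕜 W p) :=
  inferInstanceAs (TopologicalSpace (Quotient (frameSetoid 𝕜 W p)))

variable {𝕜 W} {p : ℕ}

/-- The (oriented) subspace spanned by a frame. -/
def Gr.mk (v : Frame 𝕜 W p) : Gr 𝕜 W p := Quotient.mk (frameSetoid 𝕜 W p) v

/-- A function of frames that is invariant under admissible changes of frame descends. -/
def Gr.lift {α : Sort*} (φ : Frame 𝕜 W p → α)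
    (h : ∀ v w, (frameSetoid 𝕜 W p).r v w → φ v = φ w) (P : Gr 𝕜 W p) : α :=
  Quotient.lift (s := frameSetoid 𝕜 W p) φ h P

theorem Gr.isQuotientMap_mk : Topology.IsQuotientMap (Gr.mk : Frame 𝕜 W p → Gr 𝕜 W p) :=
  isQuotientMap_quot_mk

/-- The fibre `S_P ⊆ W` of the tautological bundle: the subspace `P` itself. -/
def Gr.taut (P : Gr 𝕜 W p) : Submodule 𝕜 W :=
  Gr.lift (fun v => LinearMap.range (v.1 : Coord 𝕜 p →ₗ[𝕜] W)) (by
    rintro v w ⟨g, -, h⟩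
    rw [h]
    exact (LinearMap.range_comp_of_range_eq_top (f := (g : Coord 𝕜 p →ₗ[𝕜] Coord 𝕜 p))
      (v.1 : Coord 𝕜 p →ₗ[𝕜] W) (LinearEquiv.range g.toLinearEquiv)).symm) P

/-- The fibre `Q_P` of the quotient bundle, realised as the orthogonal complement of `S_P`. -/
def Gr.quot (P : Gr 𝕜 W p) : Submodule 𝕜 W := P.tautᗮ

end Points

section Charts

variable {𝕜 : Type*} [RCLike 𝕜] {W : Type*} [NormedAddCommGroup W] [InnerProductSpace 𝕜 W]
  {p q : ℕ}

/-- An orthonormal frame `b` of a `p`-dimensional subspace of `W` together with an orthonormal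
frame `c` of its orthogonal complement. -/
structure AdaptedFrame (𝕜 : Type*) [RCLike 𝕜] (W : Type*) [NormedAddCommGroup W]
    [InnerProductSpace 𝕜 W] (p q : ℕ) where
  b : Coord 𝕜 p →ₗᵢ[𝕜] W
  c : Coord 𝕜 q →ₗᵢ[𝕜] W
  range_c : LinearMap.range c.toLinearMap = (LinearMap.range b.toLinearMap)ᗮ

namespace AdaptedFrame

open ContinuousLinearMap

variable (F : AdaptedFrame 𝕜 W p q)

/-- `b` as a bounded operator. -/
abbrev bL : Coord 𝕜 p →L[𝕜] W := F.b.toContinuousLinearMap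
/-- `c` as a bounded operator. -/
abbrev cL : Coord 𝕜 q →L[𝕜] W := F.c.toContinuousLinearMap
theorem inner_b_c (x : Coord 𝕜 p) (y : Coord 𝕜 q) : inner 𝕜 (F.bL x) (F.cL y) = 0 := by
  have h : F.c y ∈ (LinearMap.range F.b.toLinearMap)ᗮ := by
    rw [← F.range_c]; exact ⟨y, rfl⟩
  exact (Submodule.mem_orthogonal _ _).1 h _ ⟨x, rfl⟩

variable [FiniteDimensional 𝕜 W]

/-- The `b`-coordinates of the orthogonal projection to the span of `b`. -/
abbrev bT : W →L[𝕜] Coord 𝕜 p :=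
  LinearMap.toContinuousLinearMap (LinearMap.adjoint F.b.toLinearMap)
/-- The `c`-coordinates of the orthogonal projection to the span of `c`. -/
abbrev cT : W →L[𝕜] Coord 𝕜 q :=
  LinearMap.toContinuousLinearMap (LinearMap.adjoint F.c.toLinearMap)

theorem bT_b (x : Coord 𝕜 p) : F.bT (F.bL x) = x :=
  ext_inner_right 𝕜 fun y => by
    exact (LinearMap.adjoint_inner_left F.b.toLinearMap y _).trans (F.b.inner_map_map x y)

theorem cT_c (x : Coord 𝕜 q) : F.cT (F.cL x) = x :=
  ext_inner_right 𝕜 fun y => by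
    exact (LinearMap.adjoint_inner_left F.c.toLinearMap y _).trans (F.c.inner_map_map x y)

theorem bT_c (x : Coord 𝕜 q) : F.bT (F.cL x) = 0 :=
  ext_inner_left 𝕜 fun y => by
    rw [inner_zero_right]
    exact (LinearMap.adjoint_inner_right F.b.toLinearMap y _).trans (F.inner_b_c y x)

theorem cT_b (x : Coord 𝕜 p) : F.cT (F.bL x) = 0 :=
  ext_inner_right 𝕜 fun y => by
    rw [inner_zero_left]
    exact (LinearMap.adjoint_inner_left F.c.toLinearMap y _).trans (F.inner_b_c x y)

theorem decomp (w : W) : F.bL (F.bT w) + F.cL (F.cT w) = w := by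
  have hw : w ∈ LinearMap.range F.b.toLinearMap ⊔ LinearMap.range F.c.toLinearMap := by
    rw [F.range_c, Submodule.sup_orthogonal_of_hasOrthogonalProjection]; trivial
  obtain ⟨_, ⟨x, rfl⟩, _, ⟨y, rfl⟩, rfl⟩ := Submodule.mem_sup.1 hw
  change F.bL (F.bT (F.bL x + F.cL y)) + F.cL (F.cT (F.bL x + F.cL y)) = F.bL x + F.cL y
  simp only [map_add, bT_b, bT_c, cT_b, cT_c, add_zero, zero_add]

/-- The frame `b + c T` of the graph of `T`. -/
def graphFrame (T : Coord 𝕜 p →L[𝕜] Coord 𝕜 q) : Frame 𝕜 W p :=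
  ⟨F.bL + F.cL ∘L T, Function.LeftInverse.injective (g := F.bT) fun x => by
    simp only [add_apply, comp_apply, map_add, bT_b, bT_c, add_zero]⟩

/-- The frames whose orthogonal projection to the span of `b` is a frame of the latter (which in
the real case has the same orientation as `b`). -/
def Good (v : Frame 𝕜 W p) : Prop :=
  Admissible (LinearMap.det ((F.bT ∘L v.1 : Coord 𝕜 p →L[𝕜] Coord 𝕜 p) :
    Coord 𝕜 p →ₗ[𝕜] Coord 𝕜 p))

/-- The slope `(c* v) (b* v)⁻¹` of a frame `v`. -/
def slope (v : Frame 𝕜 W p) : Coord 𝕜 p →L[𝕜] Coord 𝕜 q :=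
  (F.cT ∘L v.1) ∘L (F.bT ∘L v.1).inverse

theorem good_congr {v w : Frame 𝕜 W p} (h : (frameSetoid 𝕜 W p).r v w) (hv : F.Good v) :
    F.Good w := by
  obtain ⟨g, hg, h⟩ := h
  have : ((F.bT ∘L w.1 : Coord 𝕜 p →L[𝕜] Coord 𝕜 p) : Coord 𝕜 p →ₗ[𝕜] Coord 𝕜 p) =
      ((F.bT ∘L v.1 : Coord 𝕜 p →L[𝕜] Coord 𝕜 p) : Coord 𝕜 p →ₗ[𝕜] Coord 𝕜 p) ∘ₗ
        (g : Coord 𝕜 p →ₗ[𝕜] Coord 𝕜 p) := by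
    rw [h]; rfl
  rw [Good, this, LinearMap.det_comp]
  exact Admissible.mul hv hg

theorem slope_congr {v w : Frame 𝕜 W p} (h : (frameSetoid 𝕜 W p).r v w) :
    F.slope v = F.slope w := by
  obtain ⟨g, -, h⟩ := h
  have : F.bT ∘L w.1 = (F.bT ∘L v.1) ∘L (g : Coord 𝕜 p →L[𝕜] Coord 𝕜 p) := by
    rw [h, comp_assoc]
  rw [slope, slope, this, inverse_comp_equiv, h]
  ext1 x
  simp

theorem Good.isInvertible {v : Frame 𝕜 W p} (h : F.Good v) : (F.bT ∘L v.1).IsInvertible :=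
  ⟨(LinearMap.equivOfDetNeZero ((F.bT ∘L v.1 : Coord 𝕜 p →L[𝕜] Coord 𝕜 p) :
    Coord 𝕜 p →ₗ[𝕜] Coord 𝕜 p) h.1).toContinuousLinearEquiv, by ext1 x; rfl⟩

/-- The domain of the graph chart. -/
def source : Set (Gr 𝕜 W p) :=
  {P | Gr.lift F.Good (fun _ _ h =>
    propext ⟨F.good_congr h, F.good_congr ((frameSetoid 𝕜 W p).symm h)⟩) P}

theorem isOpen_source : IsOpen F.source := by
  rw [← Gr.isQuotientMap_mk.isOpen_preimage]
  change IsOpen {v : Frame 𝕜 W p | F.Good v}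
  refine Admissible.isOpen.preimage (f := fun v : Frame 𝕜 W p =>
    LinearMap.det ((F.bT ∘L v.1 : Coord 𝕜 p →L[𝕜] Coord 𝕜 p) :
      Coord 𝕜 p →ₗ[𝕜] Coord 𝕜 p)) ?_
  exact ContinuousLinearMap.continuous_det.comp
    (continuous_const.clm_comp continuous_subtype_val)

theorem bT_graphFrame (T : Coord 𝕜 p →L[𝕜] Coord 𝕜 q) :
    F.bT ∘L (F.graphFrame T).1 = .id 𝕜 _ := by
  ext1 x
  simp only [graphFrame, comp_apply, add_apply, map_add, bT_b, bT_c, add_zero, id_apply]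

/-- The graph chart: an (oriented) subspace which projects isomorphically to the span of `b` is the
graph of a unique linear map, which is written in the frames `b` and `c`. -/
def chart : OpenPartialHomeomorph (Gr 𝕜 W p) (Coord 𝕜 p →L[𝕜] Coord 𝕜 q) where
  toFun := Gr.lift F.slope (fun _ _ h => F.slope_congr h)
  invFun T := Gr.mk (F.graphFrame T)
  source := F.source
  target := Set.univ
  map_source' _ _ := trivial
  map_target' T _ := by
    change F.Good (F.graphFrame T)
    rw [Good, bT_graphFrame]
    change Admissible (LinearMap.det LinearMap.id)
    rw [LinearMap.det_id]
    exact Admissible.one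
  left_inv' := by
    rintro ⟨v⟩ (hv : F.Good v)
    refine Quotient.sound (s := frameSetoid 𝕜 W p) ?_
    obtain ⟨a, ha⟩ := hv.isInvertible
    have hv' := hv
    rw [Good, ← ha] at hv'
    refine ⟨a, hv', ?_⟩
    ext1 x
    change v.1 x = (F.graphFrame (F.slope v)).1 (a x)
    have hax : a x = F.bT (v.1 x) := congrArg (fun L => L x) ha
    simp only [graphFrame, slope, ← ha, inverse_equiv, add_apply, comp_apply,
      ContinuousLinearEquiv.coe_coe, ContinuousLinearEquiv.symm_apply_apply]
    rw [hax, F.decomp]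
  right_inv' T _ := by
    change F.slope (F.graphFrame T) = T
    rw [slope, bT_graphFrame, inverse_id]
    ext1 x
    simp only [graphFrame, comp_apply, add_apply, map_add, cT_b, cT_c, zero_add, id_apply]
  open_source := F.isOpen_source
  open_target := isOpen_univ
  continuousOn_toFun := by
    rw [Gr.isQuotientMap_mk.continuousOn_isOpen_iff F.isOpen_source]
    change ContinuousOn F.slope {v : Frame 𝕜 W p | F.Good v}
    intro v hv
    obtain ⟨a, ha⟩ := Good.isInvertible F hv
    have h1 : ContinuousAt (fun v : Frame 𝕜 W p => F.bT ∘L v.1) v :=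
      (continuous_const.clm_comp continuous_subtype_val).continuousAt
    have h2 : ContinuousAt (fun v : Frame 𝕜 W p => F.cT ∘L v.1) v :=
      (continuous_const.clm_comp continuous_subtype_val).continuousAt
    have h3 : ContinuousAt inverse (F.bT ∘L v.1) := by
      rw [← ha]
      exact (contDiffAt_map_inverse (𝕜 := 𝕜) (n := 0) a).continuousAt
    exact (h2.clm_comp (ContinuousAt.comp (f := fun v : Frame 𝕜 W p => F.bT ∘L v.1)
      h3 h1)).continuousWithinAt
  continuousOn_invFun := by
    refine Continuous.continuousOn (Gr.isQuotientMap_mk.continuous.comp ?_)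
    exact Continuous.subtype_mk
      (continuous_const.add (continuous_const.clm_comp continuous_id)) _

/-- The point of the Grassmannian spanned by `b`. -/
def point : Gr 𝕜 W p := Gr.mk ⟨F.bL, F.b.injective⟩

theorem point_mem_source : F.point ∈ F.source := by
  change F.Good ⟨F.bL, F.b.injective⟩
  have : F.bT ∘L F.bL = .id 𝕜 _ := by
    ext1 x
    simp only [comp_apply, bT_b, id_apply]
  rw [Good, this]
  change Admissible (LinearMap.det LinearMap.id)
  rw [LinearMap.det_id]
  exact Admissible.one

theorem contDiffOn_transition (F' : AdaptedFrame 𝕜 W p q) :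
    ContDiffOn ℝ ∞ (F'.chart ∘ F.chart.symm) (F.chart.symm ⁻¹' F'.source) := by
  intro T (hT : F'.Good (F.graphFrame T))
  obtain ⟨a, ha⟩ := Good.isInvertible F' hT
  have h0 : ContDiff 𝕜 ∞ (fun T => (F.graphFrame T).1) :=
    contDiff_const.add (contDiff_const.clm_comp contDiff_id)
  have h1 : ContDiffAt 𝕜 ∞ (fun T => F'.bT ∘L (F.graphFrame T).1) T :=
    (contDiff_const.clm_comp h0).contDiffAt
  have h2 : ContDiffAt 𝕜 ∞ (fun T => F'.cT ∘L (F.graphFrame T).1) T :=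
    (contDiff_const.clm_comp h0).contDiffAt
  have h3 : ContDiffAt 𝕜 ∞ inverse (F'.bT ∘L (F.graphFrame T).1) := by
    rw [← ha]
    exact contDiffAt_map_inverse a
  have h4 := h2.clm_comp (ContDiffAt.comp
    (f := fun T => F'.bT ∘L (F.graphFrame T).1) T h3 h1)
  exact (h4.restrict_scalars ℝ).contDiffWithinAt

instance : FiniteDimensional ℝ (Coord 𝕜 p →L[𝕜] Coord 𝕜 q) :=
  Module.Finite.trans 𝕜 (Coord 𝕜 p →L[𝕜] Coord 𝕜 q)

/-- The homomorphism from the span of `b` to the span of `c` (extended by zero) which has the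
matrix `X` in the frames `b` and `c`. -/
def hom (X : Coord 𝕜 p →L[𝕜] Coord 𝕜 q) : W →L[𝕜] W := F.cL ∘L X ∘L F.bT

theorem hom_add (X Y : Coord 𝕜 p →L[𝕜] Coord 𝕜 q) : F.hom (X + Y) = F.hom X + F.hom Y := by
  ext1 w
  simp [hom]

theorem hom_smul (r : ℝ) (X : Coord 𝕜 p →L[𝕜] Coord 𝕜 q) :
    F.hom (r • X) = (r : 𝕜) • F.hom X := by
  ext1 w
  change F.cL (r • X (F.bT w)) = (r : 𝕜) • F.cL (X (F.bT w))
  rw [RCLike.real_smul_eq_coe_smul (K := 𝕜), map_smul]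

/-- The real scalar product `Re tr (H_X* H_Y)` of two such homomorphisms. -/
def form : (Coord 𝕜 p →L[𝕜] Coord 𝕜 q) →L[ℝ] (Coord 𝕜 p →L[𝕜] Coord 𝕜 q) →L[ℝ] ℝ :=
  LinearMap.toContinuousBilinearMap
    (LinearMap.mk₂ ℝ (fun X Y => RCLike.re (LinearMap.trace 𝕜 W
      (LinearMap.adjoint (F.hom X : W →ₗ[𝕜] W) ∘ₗ (F.hom Y : W →ₗ[𝕜] W))))
      (fun X X' Y => by
        rw [F.hom_add, ContinuousLinearMap.toLinearMap_add, map_add, LinearMap.add_comp, map_add,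
          map_add])
      (fun r X Y => by
        rw [F.hom_smul, ContinuousLinearMap.toLinearMap_smul, LinearEquiv.map_smulₛₗ,
          LinearMap.smul_comp, map_smul, smul_eq_mul, RCLike.conj_ofReal, RCLike.re_ofReal_mul,
          smul_eq_mul])
      (fun X Y Y' => by
        rw [F.hom_add, ContinuousLinearMap.toLinearMap_add, LinearMap.comp_add, map_add, map_add])
      (fun r X Y => by
        rw [F.hom_smul, ContinuousLinearMap.toLinearMap_smul, LinearMap.comp_smul, map_smul,
          smul_eq_mul, RCLike.re_ofReal_mul, smul_eq_mul]))

theorem form_apply (X Y : Coord 𝕜 p →L[𝕜] Coord 𝕜 q) :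
    F.form X Y = RCLike.re (LinearMap.trace 𝕜 W
      (LinearMap.adjoint (F.hom X : W →ₗ[𝕜] W) ∘ₗ (F.hom Y : W →ₗ[𝕜] W))) := rfl

theorem form_eq (X Y : Coord 𝕜 p →L[𝕜] Coord 𝕜 q) :
    F.form X Y = ∑ i, RCLike.re
      (inner 𝕜 (X (EuclideanSpace.single i 1)) (Y (EuclideanSpace.single i 1))) := by
  have h1 : ∀ Z : Coord 𝕜 p →L[𝕜] Coord 𝕜 q, (F.hom Z : W →ₗ[𝕜] W) =
      F.c.toLinearMap ∘ₗ (Z : Coord 𝕜 p →ₗ[𝕜] Coord 𝕜 q) ∘ₗ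
        LinearMap.adjoint F.b.toLinearMap := fun Z => rfl
  have h2 : LinearMap.adjoint F.c.toLinearMap ∘ₗ F.c.toLinearMap = LinearMap.id :=
    LinearMap.ext F.cT_c
  have h3 : LinearMap.adjoint F.b.toLinearMap ∘ₗ F.b.toLinearMap = LinearMap.id :=
    LinearMap.ext F.bT_b
  have h4 : LinearMap.adjoint (F.hom X : W →ₗ[𝕜] W) ∘ₗ (F.hom Y : W →ₗ[𝕜] W) =
      F.b.toLinearMap ∘ₗ (LinearMap.adjoint (X : Coord 𝕜 p →ₗ[𝕜] Coord 𝕜 q) ∘ₗ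
        (Y : Coord 𝕜 p →ₗ[𝕜] Coord 𝕜 q)) ∘ₗ LinearMap.adjoint F.b.toLinearMap := by
    rw [h1, h1, LinearMap.adjoint_comp, LinearMap.adjoint_comp, LinearMap.adjoint_adjoint]
    ext1 w
    exact congrArg (fun z => F.b (LinearMap.adjoint (X : Coord 𝕜 p →ₗ[𝕜] Coord 𝕜 q) z))
      (F.cT_c (Y (F.bT w)))
  rw [form_apply, h4, LinearMap.trace_comp_comm', LinearMap.comp_assoc, h3, LinearMap.comp_id,
    LinearMap.trace_eq_sum_inner _ (EuclideanSpace.basisFun (Fin p) 𝕜), map_sum]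
  refine Finset.sum_congr rfl fun i _ => ?_
  rw [LinearMap.comp_apply, LinearMap.adjoint_inner_right, EuclideanSpace.basisFun_apply]
  rfl

theorem form_symm (X Y : Coord 𝕜 p →L[𝕜] Coord 𝕜 q) : F.form X Y = F.form Y X := by
  simp only [form_eq]
  exact Finset.sum_congr rfl fun i _ => inner_re_symm ..

theorem norm_sq_le (X : Coord 𝕜 p →L[𝕜] Coord 𝕜 q) : ‖X‖ ^ 2 ≤ F.form X X := by
  have h : F.form X X = ∑ i, ‖X (EuclideanSpace.single i 1)‖ ^ 2 := by
    simp only [form_eq, inner_self_eq_norm_sq]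
  have h0 : 0 ≤ F.form X X := by
    rw [h]; positivity
  rw [← Real.le_sqrt (norm_nonneg _) h0]
  refine X.opNorm_le_bound (Real.sqrt_nonneg _) fun x => ?_
  have hx : x = ∑ i, x i • EuclideanSpace.single i (1 : 𝕜) := by
    ext j
    simp [Finset.sum_apply, Pi.single_apply]
  have h1 : ‖X x‖ ≤ ∑ i, ‖X (EuclideanSpace.single i 1)‖ * ‖x i‖ := by
    conv_lhs => rw [hx]
    rw [map_sum]
    refine (norm_sum_le _ _).trans (Finset.sum_le_sum fun i _ => ?_)
    rw [map_smul, norm_smul, mul_comm]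
  refine h1.trans ((Real.sum_mul_le_sqrt_mul_sqrt _ _ _).trans (le_of_eq ?_))
  rw [h, EuclideanSpace.norm_eq]

theorem form_pos (X : Coord 𝕜 p →L[𝕜] Coord 𝕜 q) (hX : X ≠ 0) : 0 < F.form X X :=
  (pow_pos (norm_pos_iff.2 hX) 2).trans_le (F.norm_sq_le X)

theorem form_continuousAt : ContinuousAt (fun X => F.form X X) 0 :=
  (F.form.continuous.clm_apply continuous_id).continuousAt

theorem form_bounded : Bornology.IsVonNBounded ℝ {X | F.form X X < 1} := by
  refine (NormedSpace.isVonNBounded_closedBall ℝ _ 1).subset fun X hX => ?_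
  rw [mem_closedBall_zero_iff]
  exact (sq_le_one_iff₀ (norm_nonneg _)).1 ((F.norm_sq_le X).trans (le_of_lt hX))

end AdaptedFrame

variable [FiniteDimensional 𝕜 W]

theorem exists_reflection (hp : p ≠ 0) : ∃ r : Coord 𝕜 p ≃ₗᵢ[𝕜] Coord 𝕜 p,
    LinearMap.det (r.toLinearEquiv : Coord 𝕜 p →ₗ[𝕜] Coord 𝕜 p) = -1 := by
  set x : Coord 𝕜 p := EuclideanSpace.single ⟨0, Nat.pos_of_ne_zero hp⟩ 1
  have hx : x ≠ 0 := by simp [x]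
  refine ⟨(𝕜 ∙ x)ᗮ.reflection, ?_⟩
  refine ((𝕜 ∙ x)ᗮ.det_reflection).trans ?_
  rw [Submodule.orthogonal_orthogonal, finrank_span_singleton hx, pow_one]

/-- Every point of the Grassmannian is spanned by an orthonormal frame, which extends to an adapted
frame. -/
theorem exists_adaptedFrame (P : Gr 𝕜 W p) :
    ∃ F : AdaptedFrame 𝕜 W p (Module.finrank 𝕜 W - p), F.point = P := by
  obtain ⟨v⟩ := P
  set K : Submodule 𝕜 W := LinearMap.range (v.1 : Coord 𝕜 p →ₗ[𝕜] W)
  have hinj : Function.Injective (v.1 : Coord 𝕜 p →ₗ[𝕜] W) := v.2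
  have hK : Module.finrank 𝕜 K = p := by
    rw [LinearMap.finrank_range_of_inj hinj, finrank_euclideanSpace_fin]
  have hK' : Module.finrank 𝕜 Kᗮ = Module.finrank 𝕜 W - p := by
    have := K.finrank_add_finrank_orthogonal
    omega
  let b₀ : Coord 𝕜 p ≃ₗᵢ[𝕜] K :=
    ((stdOrthonormalBasis 𝕜 K).reindex (finCongr hK)).repr.symm
  let c₀ : Coord 𝕜 (Module.finrank 𝕜 W - p) ≃ₗᵢ[𝕜] Kᗮ :=
    ((stdOrthonormalBasis 𝕜 Kᗮ).reindex (finCongr hK')).repr.symm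
  let e : Coord 𝕜 p ≃ₗ[𝕜] K := LinearEquiv.ofInjective (v.1 : Coord 𝕜 p →ₗ[𝕜] W) hinj
  have key : ∃ b : Coord 𝕜 p ≃ₗᵢ[𝕜] K, Admissible
      (LinearMap.det ((b.toLinearEquiv.trans e.symm : Coord 𝕜 p ≃ₗ[𝕜] Coord 𝕜 p) :
        Coord 𝕜 p →ₗ[𝕜] Coord 𝕜 p)) := by
    set d := LinearMap.det ((b₀.toLinearEquiv.trans e.symm : Coord 𝕜 p ≃ₗ[𝕜] Coord 𝕜 p) :
        Coord 𝕜 p →ₗ[𝕜] Coord 𝕜 p) with hd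
    have hd0 : d ≠ 0 := (LinearEquiv.isUnit_det' _).ne_zero
    by_cases h : Admissible d
    · exact ⟨b₀, h⟩
    · have hI : (RCLike.I : 𝕜) = 0 := by
        by_contra hI
        exact h ⟨hd0, fun h' => (hI h').elim⟩
      have hre : RCLike.re d < 0 := by
        refine lt_of_le_of_ne (not_lt.1 fun h' => h ⟨hd0, fun _ => h'⟩) fun h' => hd0 ?_
        rw [← RCLike.re_add_im d, h', RCLike.im_eq_zero hI]
        simp
      have hp : p ≠ 0 := by
        rintro rfl
        apply h
        rw [hd, LinearMap.det_eq_one_of_finrank_eq_zero (by simp)]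
        exact Admissible.one
      obtain ⟨r, hr⟩ := exists_reflection (𝕜 := 𝕜) hp
      refine ⟨r.trans b₀, ?_⟩
      have : ((r.trans b₀).toLinearEquiv.trans e.symm : Coord 𝕜 p →ₗ[𝕜] Coord 𝕜 p) =
          ((b₀.toLinearEquiv.trans e.symm : Coord 𝕜 p ≃ₗ[𝕜] Coord 𝕜 p) :
            Coord 𝕜 p →ₗ[𝕜] Coord 𝕜 p) ∘ₗ (r.toLinearEquiv : Coord 𝕜 p →ₗ[𝕜] Coord 𝕜 p) := rfl
      rw [this, LinearMap.det_comp, ← hd, hr]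
      refine ⟨by simpa using hd0, fun _ => ?_⟩
      simpa using hre
  obtain ⟨b, hb⟩ := key
  refine ⟨⟨K.subtypeₗᵢ.comp b.toLinearIsometry, Kᗮ.subtypeₗᵢ.comp c₀.toLinearIsometry, ?_⟩, ?_⟩
  · have h1 : LinearMap.range (Kᗮ.subtypeₗᵢ.comp c₀.toLinearIsometry).toLinearMap = Kᗮ := by
      refine le_antisymm ?_ fun x hx => ⟨c₀.symm ⟨x, hx⟩, by simp⟩
      rintro _ ⟨x, rfl⟩
      exact (c₀ x).2
    have h2 : LinearMap.range (K.subtypeₗᵢ.comp b.toLinearIsometry).toLinearMap = K := by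
      refine le_antisymm ?_ fun x hx => ⟨b.symm ⟨x, hx⟩, by simp⟩
      rintro _ ⟨x, rfl⟩
      exact (b x).2
    rw [h1, h2]
  · refine (Quotient.sound (s := frameSetoid 𝕜 W p) ⟨(b.toLinearEquiv.trans
      e.symm).toContinuousLinearEquiv, hb, ?_⟩).symm
    ext1 x
    change ((b x : K) : W) = (e (e.symm (b x)) : W)
    rw [LinearEquiv.apply_symm_apply]

/-- A chosen adapted frame at a point of the Grassmannian. -/
def Gr.adaptedFrame (P : Gr 𝕜 W p) : AdaptedFrame 𝕜 W p (Module.finrank 𝕜 W - p) :=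
  (exists_adaptedFrame P).choose

theorem Gr.adaptedFrame_point (P : Gr 𝕜 W p) : P.adaptedFrame.point = P :=
  (exists_adaptedFrame P).choose_spec

variable (𝕜 W p) in
/-- The model space of `Gr_p(W)`. -/
abbrev Model : Type _ := Coord 𝕜 p →L[𝕜] Coord 𝕜 (Module.finrank 𝕜 W - p)

/-- The smooth structure of the Grassmannian, given by the graph charts. -/
instance : ChartedSpace (Model 𝕜 W p) (Gr 𝕜 W p) where
  atlas := Set.range fun F : AdaptedFrame 𝕜 W p (Module.finrank 𝕜 W - p) => F.chart
  chartAt P := P.adaptedFrame.chart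
  mem_chart_source P := by
    have := P.adaptedFrame.point_mem_source
    rwa [P.adaptedFrame_point] at this
  chart_mem_atlas P := ⟨P.adaptedFrame, rfl⟩

instance : IsManifold 𝓘(ℝ, Model 𝕜 W p) ∞ (Gr 𝕜 W p) := by
  refine isManifold_of_contDiffOn _ _ _ ?_
  intro e e' he he'
  obtain ⟨F, rfl⟩ := he
  obtain ⟨F', rfl⟩ := he'
  refine (F.contDiffOn_transition F').mono ?_
  rintro T ⟨hT, -⟩
  exact hT.2

/-- The identification of `T_P Gr_p(W)` with `Hom(S_P, Q_P)`, the homomorphisms being extended by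
zero on `Q_P`. The chart at `P` is the graph chart of the orthonormal frames `b` of `S_P` and `c` of
`Q_P`, so the curve `r ↦ [b + r c X]` has velocity `X`; the derivative at `r = 0` of its section
`(b + r c X) ξ` of the tautological bundle has the component `c X ξ` in `Q_P`. -/
def Gr.tangentHom (P : Gr 𝕜 W p) (X : TangentSpace 𝓘(ℝ, Model 𝕜 W p) P) : W →L[𝕜] W :=
  P.adaptedFrame.hom X

/-- The metric of Fubini-Study type `g_S ⊗ g_Q` on `T_P Gr_p(W) = Hom(S_P, Q_P)`. -/
def Gr.metric : RiemannianMetric (fun P : Gr 𝕜 W p => TangentSpace 𝓘(ℝ, Model 𝕜 W p) P) where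
  inner P := P.adaptedFrame.form
  symm P X Y := P.adaptedFrame.form_symm X Y
  pos P X hX := P.adaptedFrame.form_pos X hX
  continuousAt P := P.adaptedFrame.form_continuousAt
  isVonNBounded P := P.adaptedFrame.form_bounded

theorem Gr.metric_inner (P : Gr 𝕜 W p) (X Y : TangentSpace 𝓘(ℝ, Model 𝕜 W p) P) :
    Gr.metric.inner P X Y = RCLike.re (LinearMap.trace 𝕜 W
      (LinearMap.adjoint (P.tangentHom X : W →ₗ[𝕜] W) ∘ₗ (P.tangentHom Y : W →ₗ[𝕜] W))) :=
  P.adaptedFrame.form_apply X Y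

instance : RiemannianBundle (fun P : Gr 𝕜 W p => TangentSpace 𝓘(ℝ, Model 𝕜 W p) P) :=
  ⟨Gr.metric⟩

end Charts

section Riemannian

variable {E : Type*} [NormedAddCommGroup E] [NormedSpace ℝ E]
  {M : Type*} [TopologicalSpace M] [ChartedSpace E M]

instance (x : M) [FiniteDimensional ℝ E] : FiniteDimensional ℝ (TangentSpace 𝓘(ℝ, E) x) :=
  inferInstanceAs (FiniteDimensional ℝ E)

/-- The coordinate vector field `∂_u` of the chart at `x`, defined on the domain of this chart; its
value at `x` is `u`, because Mathlib identifies `T_x M` with the model space by the chart at `x`. -/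
def coordField (x : M) (u : TangentSpace 𝓘(ℝ, E) x) : (y : M) → TangentSpace 𝓘(ℝ, E) y :=
  VectorField.mpullback 𝓘(ℝ, E) 𝓘(ℝ, E) (extChartAt 𝓘(ℝ, E) x) fun _ => (u : E)

section SecondDeriv

variable {E' : Type*} [NormedAddCommGroup E'] [NormedSpace ℝ E']
  {N : Type*} [TopologicalSpace N] [ChartedSpace E' N]

/-- The second derivatives `∂_u ∂_v f` at `x` of `f`, written in the charts at `x` and at `f x`. -/
def secondDeriv (f : M → N) (x : M) (u v : TangentSpace 𝓘(ℝ, E) x) :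
    TangentSpace 𝓘(ℝ, E') (f x) :=
  (fderiv ℝ (fderiv ℝ (writtenInExtChartAt 𝓘(ℝ, E) 𝓘(ℝ, E') x f)) (extChartAt 𝓘(ℝ, E) x x)
    (u : E) (v : E) : E')

end SecondDeriv

variable [RiemannianBundle (fun x : M => TangentSpace 𝓘(ℝ, E) x)]

/-- The function `g(∂_u, ∂_v)` near `x`. -/
def coordMetric (x : M) (u v : TangentSpace 𝓘(ℝ, E) x) (y : M) : ℝ :=
  inner ℝ (coordField x u y) (coordField x v y)

/-- The Christoffel symbol of the first kind `g(∇_{∂_u} ∂_v, ∂_w)` at `x` of the Levi-Civita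
connection, given by the Koszul formula for commuting vector fields. -/
def christoffelForm (x : M) (u v w : TangentSpace 𝓘(ℝ, E) x) : ℝ :=
  (mvfderiv 𝓘(ℝ, E) (coordMetric x v w) x u + mvfderiv 𝓘(ℝ, E) (coordMetric x u w) x v
    - mvfderiv 𝓘(ℝ, E) (coordMetric x u v) x w) / 2

variable [FiniteDimensional ℝ E]

/-- An orthonormal basis of `T_x M`. -/
def onb (x : M) := stdOrthonormalBasis ℝ (TangentSpace 𝓘(ℝ, E) x)

/-- The value `∇_{∂_u} ∂_v` at `x` of the Levi-Civita connection. -/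
def christoffel (x : M) (u v : TangentSpace 𝓘(ℝ, E) x) : TangentSpace 𝓘(ℝ, E) x :=
  ∑ i, christoffelForm x u v (onb x i) • onb x i

variable {E' : Type*} [NormedAddCommGroup E'] [NormedSpace ℝ E'] [FiniteDimensional ℝ E']
  {N : Type*} [TopologicalSpace N] [ChartedSpace E' N]
  [RiemannianBundle (fun y : N => TangentSpace 𝓘(ℝ, E') y)]

/-- The second fundamental form `∇df` of a map `f` between Riemannian manifolds, computed at `x` in
the charts at `x` and at `f x`:
`(∇df)(u, v) = ∂_u ∂_v f - df(∇_{∂_u} ∂_v) + ∇_{df(u)} ∂_{df(v)}`. -/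
def secondFundamentalForm (f : M → N) (x : M) (u v : TangentSpace 𝓘(ℝ, E) x) :
    TangentSpace 𝓘(ℝ, E') (f x) :=
  secondDeriv f x u v - mfderiv 𝓘(ℝ, E) 𝓘(ℝ, E') f x (christoffel x u v)
    + christoffel (f x) (mfderiv 𝓘(ℝ, E) 𝓘(ℝ, E') f x u) (mfderiv 𝓘(ℝ, E) 𝓘(ℝ, E') f x v)

variable (E E')

/-- The tension field `τ(f) = trace ∇df`. -/
def tensionField (f : M → N) (x : M) : TangentSpace 𝓘(ℝ, E') (f x) :=
  ∑ i, secondFundamentalForm f x (onb (E := E) x i) (onb (E := E) x i)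

/-- Harmonic maps: the tension field vanishes. -/
def IsHarmonic (f : M → N) : Prop := ∀ x, tensionField E E' f x = 0

/-- The energy density `e(f) = |df|²`. -/
def energyDensity (f : M → N) (x : M) : ℝ :=
  ∑ i, ‖mfderiv 𝓘(ℝ, E) 𝓘(ℝ, E') f x (onb (E := E) x i)‖ ^ 2

/-- Isometric immersions: `df` preserves the scalar products of tangent vectors. -/
def IsIsometricImmersion (f : M → N) : Prop :=
  ∀ (x : M) (u v : TangentSpace 𝓘(ℝ, E) x), inner ℝ (mfderiv 𝓘(ℝ, E) 𝓘(ℝ, E') f x u)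
    (mfderiv 𝓘(ℝ, E) 𝓘(ℝ, E') f x v) = inner ℝ u v

end Riemannian

section Bundles

variable {𝕜 : Type*} [RCLike 𝕜] {W : Type*} [NormedAddCommGroup W] [InnerProductSpace 𝕜 W]
  [FiniteDimensional 𝕜 W] [NormedSpace ℝ W] {p : ℕ}
  {E : Type*} [NormedAddCommGroup E] [NormedSpace ℝ E]
  {M : Type*} [TopologicalSpace M] [ChartedSpace E M]

/-- The section of the subbundle `B` of the trivial bundle `M × W` which corresponds to `w ∈ W`, by
orthogonal projection. -/
def sectionOf (B : M → Submodule 𝕜 W) (w : W) (x : M) : B x := (B x).orthogonalProjectionOnto w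

/-- The connection `∇ t = π_B d t` induced on a subbundle `B` of the trivial bundle `M × W`. -/
def covDeriv (B : M → Submodule 𝕜 W) (t : (x : M) → B x) (x : M)
    (X : TangentSpace 𝓘(ℝ, E) x) : B x :=
  (B x).orthogonalProjectionOnto (mvfderiv 𝓘(ℝ, E) (fun y => (t y : W)) x X)

/-- The second fundamental form `s ↦ π_{B^⊥} d s` of a subbundle `B` of the trivial bundle
`M × W`. It is tensorial in `s`, and `b ∈ B_x` is extended to the section corresponding to `b`. -/
def secondFund (B : M → Submodule 𝕜 W) (x : M) (X : TangentSpace 𝓘(ℝ, E) x) (b : B x) :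
    ((B x)ᗮ : Submodule 𝕜 W) :=
  (B x)ᗮ.orthogonalProjectionOnto (mvfderiv 𝓘(ℝ, E) (fun y => (sectionOf B (b : W) y : W)) x X)

/-- The pull-back `U = f^*S` of the tautological bundle, a subbundle of `M × W`. -/
def pullTaut (f : M → Gr 𝕜 W p) (x : M) : Submodule 𝕜 W := (f x).taut

/-- The pull-back `V = f^*Q` of the quotient bundle, the orthogonal complement of `U`. -/
def pullQuot (f : M → Gr 𝕜 W p) (x : M) : Submodule 𝕜 W := (f x).quot

/-- The second fundamental form `H_X : U_x → V_x` of `U`. -/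
def formH (f : M → Gr 𝕜 W p) (x : M) (X : TangentSpace 𝓘(ℝ, E) x) (u : pullTaut f x) :
    pullQuot f x :=
  secondFund (pullTaut f) x X u

/-- The second fundamental form `K_X : V_x → U_x` of `V`. -/
def formK (f : M → Gr 𝕜 W p) (x : M) (X : TangentSpace 𝓘(ℝ, E) x) (v : pullQuot f x) :
    pullTaut f x :=
  ⟨secondFund (pullQuot f) x X v,
    (Submodule.orthogonal_orthogonal (pullTaut f x)).le (secondFund (pullQuot f) x X v).2⟩

variable [FiniteDimensional ℝ E] [RiemannianBundle (fun x : M => TangentSpace 𝓘(ℝ, E) x)]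

variable (E) in
/-- The mean curvature operator `A = ∑ H_{e_i} K_{e_i}` of `f`, acting on `V`. -/
def meanCurvatureOperator (f : M → Gr 𝕜 W p) (x : M) (v : pullQuot f x) : pullQuot f x :=
  ∑ i, formH f x (onb (E := E) x i) (formK f x (onb (E := E) x i) v)

/-- The second covariant derivative `∇_u (∇ t) (v) = ∇_u (∇_{∂_v} t) - ∇_{∇_u ∂_v} t` of a section,
where `∇_u ∂_v` is the Levi-Civita connection of `M`. -/
def covHessian (B : M → Submodule 𝕜 W) (t : (x : M) → B x) (x : M)
    (u v : TangentSpace 𝓘(ℝ, E) x) : B x :=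
  covDeriv (E := E) B (fun y => covDeriv B t y (coordField x v y)) x u
    - covDeriv B t x (christoffel x u v)

variable (E) in
/-- The Laplace operator `Δ = ∇^*∇ = - trace ∇∇` on sections of a subbundle of `M × W`. -/
def bundleLaplacian (B : M → Submodule 𝕜 W) (t : (x : M) → B x) (x : M) : B x :=
  -∑ i, covHessian B t x (onb (E := E) x i) (onb (E := E) x i)

/-- `A_x = -h(x) Id_V` for every `x`. -/
def HasMeanCurvature (E : Type*) [NormedAddCommGroup E] [NormedSpace ℝ E] {M : Type*}
    [TopologicalSpace M] [ChartedSpace E M] [FiniteDimensional ℝ E]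
    [RiemannianBundle (fun x : M => TangentSpace 𝓘(ℝ, E) x)] (f : M → Gr 𝕜 W p) (h : M → 𝕜) :
    Prop :=
  ∀ (x : M) (v : pullQuot f x), meanCurvatureOperator E f x v = -(h x • v)

/-- `Δ t = h t` for every `t ∈ W`, where `w ∈ W` is regarded as the section `x ↦ π_V(w)` of `V`. -/
def SatisfiesLaplace (E : Type*) [NormedAddCommGroup E] [NormedSpace ℝ E] {M : Type*}
    [TopologicalSpace M] [ChartedSpace E M] [FiniteDimensional ℝ E]
    [RiemannianBundle (fun x : M => TangentSpace 𝓘(ℝ, E) x)] (f : M → Gr 𝕜 W p) (h : M → 𝕜) :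
    Prop :=
  ∀ (w : W) (x : M), bundleLaplacian E (pullQuot f) (sectionOf (pullQuot f) w) x =
    h x • sectionOf (pullQuot f) w x

end Bundles

end Grassmann

end

/-! Everything is read off from the map `π` which sends a subspace `P` to its orthogonal projection.
In the graph chart at `P`, with adapted frames `b` of `S_P` and `c` of `Q_P`, put `H = c T b*`. The
graph of `T` is fixed by its projection and the vectors `c y - b T* y` are killed, hence `π(T) (1 +
H - H*) = b b* + H` (`AdaptedFrame.proj_graphFrame`). Differentiating this algebraic identity at `T
= 0` gives smoothness, `dπ(X) = H_X + H_X*`, and a second derivative which is block diagonal in `S_P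
⊕ Q_P`.

Applied to the identity of the Grassmannian, this controls the metric: `g(X, Y)` is half of `Re tr
(dπ(X)* dπ(Y))`. A derivative of `g` at the centre of a graph chart pairs a block diagonal operator
with an off-diagonal one, so it vanishes. The Christoffel symbols are therefore zero there
(`Gr.christoffel_eq_zero`), and the tension field is the trace of the plain second derivative of
`f`, corrected only by the connection of `M`.

Applied to `f`, it controls the sections `t = (1 - π) w`: one has `∇_v t = -(1 - π) (∂_v π) w`, and
differentiating and projecting once more yields (`coe_bundleLaplacian`) `Δ t = H_τ w - A t`, where
`τ` is the tension field. The operator `H_τ` sees only the `U`-component of `w`, and `A t` only the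
`V`-component. Testing `Δ t = h t` on `w ∈ U` gives `τ = 0`, and on `w ∈ V` it gives `A = -h Id`;
the converse is substitution.

Since `K = -H*`, the operator `-A = ∑ H_{e_i} H_{e_i}*` has real trace equal to the energy density,
so `-A = h Id` forces `e(f) = q h` (`AdaptedFrame.sum_form_eq`). -/

noncomputable section

namespace Grassmann

/-! ### Differentiating the equation `s (1 + t - t') = B + t` in a normed algebra -/

section Calculus

open Filter Topology

variable {E : Type*} [NormedAddCommGroup E] [NormedSpace ℝ E] {R : Type*} [NormedRing R]
  [NormedAlgebra ℝ R] {s t t' : E → R} {ξ : E} {B : R}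

/-- With the inner direction frozen, a second derivative is the first derivative of a map with the
same codomain as `g`, so the ordinary product rule can be used again. -/
theorem hasFDerivAt_fderiv_apply {F : Type*} [NormedAddCommGroup F] [NormedSpace ℝ F] {g : E → F}
    (hg : ContDiffAt ℝ 2 g ξ) (v : E) :
    HasFDerivAt (fun η => fderiv ℝ g η v) ((fderiv ℝ (fderiv ℝ g) ξ).flip v) ξ := by
  have h1 : DifferentiableAt ℝ (fderiv ℝ g) ξ :=
    (hg.fderiv_right (m := 1) (by norm_num)).differentiableAt one_ne_zero
  exact h1.hasFDerivAt.clm_apply (hasFDerivAt_const v ξ) |>.congr_fderiv (by ext; simp)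

/-- The first derivative of the equation `s (1 + t - t') = B + t`. -/
theorem fderiv_of_mul_eq (hs : DifferentiableAt ℝ s ξ) (ht : DifferentiableAt ℝ t ξ)
    (ht' : DifferentiableAt ℝ t' ξ)
    (h : ∀ᶠ η in 𝓝 ξ, s η * (1 + t η - t' η) = B + t η) (u : E) :
    fderiv ℝ s ξ u * (1 + t ξ - t' ξ) + s ξ * (fderiv ℝ t ξ u - fderiv ℝ t' ξ u) =
      fderiv ℝ t ξ u := by
  have h1 := hs.hasFDerivAt.mul' ((ht.hasFDerivAt.const_add 1).sub ht'.hasFDerivAt)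
  have h2 := (ht.hasFDerivAt.const_add B).congr_of_eventuallyEq h
  have h3 := congrArg (fun L => L u) (h1.unique h2)
  refine Eq.trans ?_ h3
  rw [add_comm]
  simp

/-- The second derivative of the equation `s (1 + t - t') = B + t`. -/
theorem fderiv_fderiv_of_mul_eq (hs : ContDiffAt ℝ 2 s ξ) (ht : ContDiffAt ℝ 2 t ξ)
    (ht' : ContDiffAt ℝ 2 t' ξ)
    (h : ∀ᶠ η in 𝓝 ξ, s η * (1 + t η - t' η) = B + t η) (u v : E) :
    fderiv ℝ (fderiv ℝ s) ξ u v * (1 + t ξ - t' ξ)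
      + fderiv ℝ s ξ v * (fderiv ℝ t ξ u - fderiv ℝ t' ξ u)
      + (fderiv ℝ s ξ u * (fderiv ℝ t ξ v - fderiv ℝ t' ξ v)
      + s ξ * (fderiv ℝ (fderiv ℝ t) ξ u v - fderiv ℝ (fderiv ℝ t') ξ u v)) =
      fderiv ℝ (fderiv ℝ t) ξ u v := by
  have key : ∀ {g : E → R}, ContDiffAt ℝ 2 g ξ → ∀ᶠ η in 𝓝 ξ, DifferentiableAt ℝ g η :=
    fun hg => (hg.eventually (by simp)).mono fun η hη => hη.differentiableAt two_ne_zero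
  -- The first-order identity holds on a whole neighbourhood of `ξ`, so it may be differentiated
  -- again.
  have h0 : ∀ᶠ η in 𝓝 ξ, fderiv ℝ s η v * (1 + t η - t' η)
      + s η * (fderiv ℝ t η v - fderiv ℝ t' η v) = fderiv ℝ t η v := by
    filter_upwards [key hs, key ht, key ht', eventually_eventually_nhds.2 h] with η a b c d
    exact fderiv_of_mul_eq a b c d v
  have ds := (hs.differentiableAt two_ne_zero).hasFDerivAt
  have dt := (ht.differentiableAt two_ne_zero).hasFDerivAt
  have dt' := (ht'.differentiableAt two_ne_zero).hasFDerivAt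
  have h1 := ((hasFDerivAt_fderiv_apply hs v).mul' ((dt.const_add 1).sub dt')).add
    (ds.mul' ((hasFDerivAt_fderiv_apply ht v).sub (hasFDerivAt_fderiv_apply ht' v)))
  have h2 := (hasFDerivAt_fderiv_apply ht v).congr_of_eventuallyEq h0
  have h3 := congrArg (fun L => L u) (h1.unique h2)
  simp only [ContinuousLinearMap.flip_apply] at h3
  refine Eq.trans ?_ h3
  simp
  abel

section Linear

variable {G H : Type*} [NormedAddCommGroup G] [NormedSpace ℝ G] [NormedAddCommGroup H]
  [NormedSpace ℝ H] {g : E → G}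

theorem fderiv_clm_comp (L : G →L[ℝ] H) (hg : ContDiffAt ℝ 2 g ξ) (u : E) :
    fderiv ℝ (fun η => L (g η)) ξ u = L (fderiv ℝ g ξ u) :=
  congrArg (fun L => L u)
    (L.hasFDerivAt.comp ξ (hg.differentiableAt two_ne_zero).hasFDerivAt).fderiv

theorem fderiv_fderiv_clm_comp (L : G →L[ℝ] H) (hg : ContDiffAt ℝ 2 g ξ) (u v : E) :
    fderiv ℝ (fderiv ℝ (fun η => L (g η))) ξ u v = L (fderiv ℝ (fderiv ℝ g) ξ u v) := by
  have h1 : (fun η => fderiv ℝ (fun η => L (g η)) η v) =ᶠ[𝓝 ξ] fun η => L (fderiv ℝ g η v) := by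
    filter_upwards [hg.eventually (by simp)] with η hη
    exact fderiv_clm_comp L hη v
  have h2 := hasFDerivAt_fderiv_apply (ContDiffAt.continuousLinearMap_comp L hg) v
  have h3 := (L.hasFDerivAt.comp _ (hasFDerivAt_fderiv_apply hg v)).congr_of_eventuallyEq h1
  exact congrArg (fun L => L u) (h2.unique h3)

variable {L L' : G →L[ℝ] R}

/-- The intended case is `B = b b*`, `L X = c X b*`, `L' X = b X* c*`. At `ξ` the factor multiplying
the derivative of `s` is `1`, while `B` kills the values of `L` and fixes those of `L'`. -/
theorem fderiv_of_mul_clm_eq (hs : DifferentiableAt ℝ s ξ) (hg : ContDiffAt ℝ 2 g ξ)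
    (h : ∀ᶠ η in 𝓝 ξ, s η * (1 + L (g η) - L' (g η)) = B + L (g η)) (hg0 : g ξ = 0)
    (hs0 : s ξ = B) (h1 : ∀ X, B * L X = 0) (h2 : ∀ X, B * L' X = L' X) (u : E) :
    fderiv ℝ s ξ u = L (fderiv ℝ g ξ u) + L' (fderiv ℝ g ξ u) := by
  have dg := hg.differentiableAt two_ne_zero
  have e := fderiv_of_mul_eq hs (L.differentiableAt.comp ξ dg) (L'.differentiableAt.comp ξ dg) h u
  simp only [Function.comp_def, fderiv_clm_comp _ hg, hg0, hs0, map_zero, add_zero, sub_zero,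
    mul_one, mul_sub, h1, h2, zero_sub] at e
  rwa [← sub_eq_add_neg, sub_eq_iff_eq_add] at e

/-- Products of two values of `L`, or of two values of `L'`, vanish. The quadratic terms that
survive are the mixed ones, symmetrised in `u` and `v`. -/
theorem fderiv_fderiv_of_mul_clm_eq (hs : ContDiffAt ℝ 2 s ξ) (hg : ContDiffAt ℝ 2 g ξ)
    (h : ∀ᶠ η in 𝓝 ξ, s η * (1 + L (g η) - L' (g η)) = B + L (g η)) (hg0 : g ξ = 0)
    (hs0 : s ξ = B) (h1 : ∀ X, B * L X = 0) (h2 : ∀ X, B * L' X = L' X)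
    (h3 : ∀ X Y, L X * L Y = 0) (h4 : ∀ X Y, L' X * L' Y = 0) (u v : E) :
    fderiv ℝ (fderiv ℝ s) ξ u v = L (fderiv ℝ (fderiv ℝ g) ξ u v)
      + L' (fderiv ℝ (fderiv ℝ g) ξ u v)
      + L (fderiv ℝ g ξ u) * L' (fderiv ℝ g ξ v) - L' (fderiv ℝ g ξ u) * L (fderiv ℝ g ξ v)
      + L (fderiv ℝ g ξ v) * L' (fderiv ℝ g ξ u) - L' (fderiv ℝ g ξ v) * L (fderiv ℝ g ξ u) := by
  have e := fderiv_fderiv_of_mul_eq (t := fun η => L (g η)) (t' := fun η => L' (g η)) hs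
    (ContDiffAt.continuousLinearMap_comp L hg)
    (ContDiffAt.continuousLinearMap_comp L' hg) h u v
  simp only [fderiv_clm_comp _ hg, fderiv_fderiv_clm_comp _ hg,
    fderiv_of_mul_clm_eq (hs.differentiableAt two_ne_zero) hg h hg0 hs0 h1 h2, hg0, hs0, map_zero,
    add_zero, sub_zero, mul_one, mul_sub, add_mul, h1, h2, h3, h4, zero_sub, zero_add] at e
  rw [← sub_eq_zero] at e ⊢
  rw [← e]
  abel

end Linear

/-- Near `ξ` the factor `1 + t - t'` is close to `1`, hence a unit, and the equation can be solved
for `s`; inversion is smooth on units. -/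
theorem contDiffAt_of_mul_eq [CompleteSpace R] {n : WithTop ℕ∞} (ht : ContDiffAt ℝ n t ξ)
    (ht' : ContDiffAt ℝ n t' ξ) (h0 : t ξ = 0) (h0' : t' ξ = 0)
    (h : ∀ᶠ η in 𝓝 ξ, s η * (1 + t η - t' η) = B + t η) : ContDiffAt ℝ n s ξ := by
  have hΦ : ContDiffAt ℝ n (fun η => 1 + t η - t' η) ξ := (contDiffAt_const.add ht).sub ht'
  have h1 : 1 + t ξ - t' ξ = ((1 : Rˣ) : R) := by simp [h0, h0']
  have hi : ContDiffAt ℝ n (fun η => Ring.inverse (1 + t η - t' η)) ξ := by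
    refine ContDiffAt.comp (g := Ring.inverse) ξ ?_ hΦ
    rw [h1]
    exact contDiffAt_ringInverse ℝ (1 : Rˣ)
  refine ((contDiffAt_const (c := B)).add ht |>.mul hi).congr_of_eventuallyEq ?_
  have hu : ∀ᶠ η in 𝓝 ξ, IsUnit (1 + t η - t' η) :=
    hΦ.continuousAt.eventually (Units.isOpen.mem_nhds (by simp [h0, h0']))
  filter_upwards [h, hu] with η e f
  rw [← e, mul_assoc, Ring.mul_inverse_cancel _ f, mul_one]

end Calculus

/-! ### Coordinate vector fields as derivatives in a chart -/

section CoordField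

open Filter Topology

variable {E : Type*} [NormedAddCommGroup E] [NormedSpace ℝ E]
  {M : Type*} [TopologicalSpace M] [ChartedSpace E M] [IsManifold 𝓘(ℝ, E) 1 M]
  {F : Type*} [NormedAddCommGroup F] [NormedSpace ℝ F]

theorem mfderiv_extChartAt_coordField {x y : M} (hy : y ∈ (extChartAt 𝓘(ℝ, E) x).source)
    (v : TangentSpace 𝓘(ℝ, E) x) :
    (mfderiv 𝓘(ℝ, E) 𝓘(ℝ, E) (extChartAt 𝓘(ℝ, E) x) y (coordField x v y) : E) = v := by
  have h := isInvertible_mfderiv_extChartAt (I := 𝓘(ℝ, E)) hy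
  exact congrArg (fun L => L (show TangentSpace 𝓘(ℝ, E) (extChartAt 𝓘(ℝ, E) x y) from v))
    h.self_comp_inverse

/-- This is needed at every `y` of the chart domain, not only at its centre, because covariant
derivatives and metric coefficients along `∂_v` are differentiated a second time. -/
theorem mvfderiv_coordField {x y : M} (hy : y ∈ (extChartAt 𝓘(ℝ, E) x).source) {g : E → F}
    (hg : DifferentiableAt ℝ g (extChartAt 𝓘(ℝ, E) x y)) {k : M → F}
    (hk : k =ᶠ[𝓝 y] g ∘ extChartAt 𝓘(ℝ, E) x) (v : TangentSpace 𝓘(ℝ, E) x) :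
    mvfderiv 𝓘(ℝ, E) k y (coordField x v y) = fderiv ℝ g (extChartAt 𝓘(ℝ, E) x y) v := by
  have h1 : HasMFDerivAt 𝓘(ℝ, E) 𝓘(ℝ, F) (g ∘ extChartAt 𝓘(ℝ, E) x) y _ :=
    HasMFDerivAt.comp y hg.hasFDerivAt.hasMFDerivAt
      (mdifferentiableAt_extChartAt (by simpa using hy)).hasMFDerivAt
  have h2 := (h1.congr_of_eventuallyEq hk).mfderiv
  have h3 := congrArg (fun L => L (coordField x v y)) h2
  refine h3.trans ?_
  change fderiv ℝ g (extChartAt 𝓘(ℝ, E) x y)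
    (mfderiv 𝓘(ℝ, E) 𝓘(ℝ, E) (extChartAt 𝓘(ℝ, E) x) y (coordField x v y) : E) = _
  rw [mfderiv_extChartAt_coordField hy]

theorem coordField_self (x : M) (v : TangentSpace 𝓘(ℝ, E) x) : coordField x v x = v := by
  refine (congrArg (fun L : E →L[ℝ] E => L.inverse v)
    (mfderiv_extChartAt_self (I := 𝓘(ℝ, E)) (x := x))).trans ?_
  exact congrArg (fun L : E →L[ℝ] E => L v) ContinuousLinearMap.inverse_id

theorem mvfderiv_eq_fderiv {x : M} {g : E → F}
    (hg : DifferentiableAt ℝ g (extChartAt 𝓘(ℝ, E) x x)) {k : M → F}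
    (hk : k =ᶠ[𝓝 x] g ∘ extChartAt 𝓘(ℝ, E) x) (v : TangentSpace 𝓘(ℝ, E) x) :
    mvfderiv 𝓘(ℝ, E) k x v = fderiv ℝ g (extChartAt 𝓘(ℝ, E) x x) v := by
  rw [← mvfderiv_coordField (mem_extChartAt_source x) hg hk, coordField_self]

end CoordField

/-! ### Orthogonal projections in graph charts -/

section Projections

open Filter Topology

variable {𝕜 : Type*} [RCLike 𝕜] {W : Type*} [NormedAddCommGroup W] [InnerProductSpace 𝕜 W]
  [FiniteDimensional 𝕜 W] {p q : ℕ}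

namespace AdaptedFrame

variable (F : AdaptedFrame 𝕜 W p q)

/-- The adjoint `b X* c*` of `F.hom X = c X b*`. -/
def homT (X : Coord 𝕜 p →L[𝕜] Coord 𝕜 q) : W →L[𝕜] W :=
  F.bL ∘L ContinuousLinearMap.adjoint X ∘L F.cT

theorem inner_bT_right (x : W) (y : Coord 𝕜 p) : inner 𝕜 y (F.bT x) = inner 𝕜 (F.bL y) x :=
  LinearMap.adjoint_inner_right F.b.toLinearMap y x

theorem inner_cT_right (x : W) (y : Coord 𝕜 q) : inner 𝕜 y (F.cT x) = inner 𝕜 (F.cL y) x :=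
  LinearMap.adjoint_inner_right F.c.toLinearMap y x

/-- With `x = b* w` and `y = c* w`, the argument is the sum of `b x + c T x`, which lies in the
graph, and `c y - b T* y`, which is orthogonal to it. No inverse of `1 + T* T` is needed. -/
theorem starProjection_graphFrame (T : Coord 𝕜 p →L[𝕜] Coord 𝕜 q) (w : W) :
    (Gr.mk (F.graphFrame T)).taut.starProjection (w + F.hom T w - F.homT T w) =
      F.bL (F.bT w) + F.hom T w := by
  have h1 : w + F.hom T w - F.homT T w = (F.bL (F.bT w) + F.cL (T (F.bT w))) +
      (F.cL (F.cT w) - F.bL (ContinuousLinearMap.adjoint T (F.cT w))) := by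
    conv_lhs => enter [1, 1]; rw [← F.decomp w]
    change F.bL (F.bT w) + F.cL (F.cT w) + F.cL (T (F.bT w)) -
      F.bL (ContinuousLinearMap.adjoint T (F.cT w)) = _
    abel
  have h2 : F.bL (F.bT w) + F.cL (T (F.bT w)) ∈ (Gr.mk (F.graphFrame T)).taut := ⟨F.bT w, rfl⟩
  have h3 : F.cL (F.cT w) - F.bL (ContinuousLinearMap.adjoint T (F.cT w)) ∈
      (Gr.mk (F.graphFrame T)).tautᗮ := by
    rintro _ ⟨x, rfl⟩
    change inner 𝕜 (F.bL x + F.cL (T x)) _ = 0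
    simp only [inner_sub_right, inner_add_left]
    rw [F.inner_b_c, ← F.inner_cT_right, ← F.inner_bT_right, ← F.inner_cT_right, F.cT_c, F.bT_b,
      F.cT_b, inner_zero_right, ContinuousLinearMap.adjoint_inner_right]
    ring
  rw [h1, map_add, Submodule.starProjection_eq_self_iff.2 h2,
    (Submodule.starProjection_apply_eq_zero_iff _).2 h3, add_zero]
  rfl

variable [NormedSpace ℝ W] [IsScalarTower ℝ 𝕜 W]

/-- `X ↦ c X b*`, with values in the real-linear operators. -/
def homR : (Coord 𝕜 p →L[𝕜] Coord 𝕜 q) →L[ℝ] (W →L[ℝ] W) :=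
  LinearMap.toContinuousLinearMap
    { toFun := fun X => (F.hom X).restrictScalars ℝ
      map_add' := fun X Y => by ext w; simp [hom]
      map_smul' := fun r X => by
        ext w
        change F.cL (r • X (F.bT w)) = r • F.cL (X (F.bT w))
        exact (F.cL.restrictScalars ℝ).map_smul r _ }

/-- `X ↦ b X* c*`, with values in the real-linear operators. -/
def homTR : (Coord 𝕜 p →L[𝕜] Coord 𝕜 q) →L[ℝ] (W →L[ℝ] W) :=
  LinearMap.toContinuousLinearMap
    { toFun := fun X => (F.homT X).restrictScalars ℝ
      map_add' := fun X Y => by ext w; simp [homT]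
      map_smul' := fun r X => by
        ext w
        change F.bL (ContinuousLinearMap.adjoint (r • X) (F.cT w)) =
          r • F.bL (ContinuousLinearMap.adjoint X (F.cT w))
        -- The adjoint is conjugate-linear over `𝕜`; only real scalars come out unchanged, which is
        -- why all operators are taken real-linear.
        have h : r • X = (r : 𝕜) • X := by
          ext1 x; exact RCLike.real_smul_eq_coe_smul (K := 𝕜) _ _
        rw [h, map_smulₛₗ, RCLike.conj_ofReal, ← RCLike.real_smul_eq_coe_smul]
        exact (F.bL.restrictScalars ℝ).map_smul r _ }

/-- The orthogonal projection `b b*`. -/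
def projB : W →L[ℝ] W := (F.bL ∘L F.bT).restrictScalars ℝ

/-- The orthogonal projection `c c*`. -/
def projC : W →L[ℝ] W := (F.cL ∘L F.cT).restrictScalars ℝ

theorem homR_apply (X : Coord 𝕜 p →L[𝕜] Coord 𝕜 q) (w : W) :
    F.homR X w = F.cL (X (F.bT w)) := rfl

theorem homTR_apply (X : Coord 𝕜 p →L[𝕜] Coord 𝕜 q) (w : W) :
    F.homTR X w = F.bL (ContinuousLinearMap.adjoint X (F.cT w)) := rfl

theorem projC_apply (w : W) : F.projC w = F.cL (F.cT w) := rfl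

theorem projB_add_projC : F.projB + F.projC = 1 := ContinuousLinearMap.ext F.decomp

/-- This and the following products form the multiplication table of blocks for the splitting of `W`
into the spans of `b` and `c`: `homR` maps the first into the second, `homTR` the second into the
first. -/
theorem projB_mul_homR (X : Coord 𝕜 p →L[𝕜] Coord 𝕜 q) : F.projB * F.homR X = 0 := by
  ext w
  change F.bL (F.bT (F.cL _)) = 0
  rw [F.bT_c, map_zero]

theorem projB_mul_homTR (X : Coord 𝕜 p →L[𝕜] Coord 𝕜 q) : F.projB * F.homTR X = F.homTR X := by
  ext w
  change F.bL (F.bT (F.bL _)) = F.bL _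
  rw [F.bT_b]

theorem projC_mul_homR (X : Coord 𝕜 p →L[𝕜] Coord 𝕜 q) : F.projC * F.homR X = F.homR X := by
  ext w
  change F.cL (F.cT (F.cL _)) = F.cL _
  rw [F.cT_c]

theorem projC_mul_homTR (X : Coord 𝕜 p →L[𝕜] Coord 𝕜 q) : F.projC * F.homTR X = 0 := by
  ext w
  change F.cL (F.cT (F.bL _)) = 0
  rw [F.cT_b, map_zero]

theorem homR_mul_homR (X Y : Coord 𝕜 p →L[𝕜] Coord 𝕜 q) : F.homR X * F.homR Y = 0 := by
  ext w
  change F.cL (X (F.bT (F.cL _))) = 0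
  rw [F.bT_c, map_zero, map_zero]

theorem homTR_mul_homTR (X Y : Coord 𝕜 p →L[𝕜] Coord 𝕜 q) : F.homTR X * F.homTR Y = 0 := by
  ext w
  change F.bL (ContinuousLinearMap.adjoint X (F.cT (F.bL _))) = 0
  rw [F.cT_b, map_zero, map_zero]

end AdaptedFrame

variable [NormedSpace ℝ W] [IsScalarTower ℝ 𝕜 W]

/-- The orthogonal projection to the subspace `P`, as a real-linear operator on `W`. -/
def Gr.proj (P : Gr 𝕜 W p) : W →L[ℝ] W := P.taut.starProjection.restrictScalars ℝ

theorem Gr.starProjection_quot (P : Gr 𝕜 W p) (w : W) :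
    P.quot.starProjection w = (1 - P.proj) w := by
  change P.tautᗮ.starProjection w = w - P.taut.starProjection w
  rw [Submodule.starProjection_orthogonal_val]

theorem AdaptedFrame.proj_graphFrame (F : AdaptedFrame 𝕜 W p q)
    (T : Coord 𝕜 p →L[𝕜] Coord 𝕜 q) :
    (Gr.mk (F.graphFrame T)).proj * (1 + F.homR T - F.homTR T) = F.projB + F.homR T :=
  ContinuousLinearMap.ext fun w => F.starProjection_graphFrame T w

omit [NormedSpace ℝ W] [IsScalarTower ℝ 𝕜 W] in
-- The slope of `b` has the factor `c* b = 0`. The frame is arbitrary so that `P` can be eliminated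
-- by `subst`, which is impossible for `P.adaptedFrame`, itself dependent on `P`.
theorem AdaptedFrame.chart_eq_zero (F : AdaptedFrame 𝕜 W p q) {P : Gr 𝕜 W p}
    (h : F.point = P) : F.chart P = 0 := by
  subst h
  change (F.cT ∘L F.bL) ∘L _ = 0
  have : F.cT ∘L F.bL = 0 := by
    ext1 x
    exact F.cT_b x
  rw [this, ContinuousLinearMap.zero_comp]

omit [NormedSpace ℝ W] [IsScalarTower ℝ 𝕜 W] in
theorem Gr.chart_self (P : Gr 𝕜 W p) : P.adaptedFrame.chart P = 0 :=
  P.adaptedFrame.chart_eq_zero P.adaptedFrame_point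

theorem Gr.proj_eq (P : Gr 𝕜 W p) : P.proj = P.adaptedFrame.projB := by
  have h := P.adaptedFrame.proj_graphFrame 0
  have h0 : Gr.mk (P.adaptedFrame.graphFrame 0) = P := by
    rw [← P.chart_self]
    exact P.adaptedFrame.chart.left_inv (by
      have := P.adaptedFrame.point_mem_source
      rwa [P.adaptedFrame_point] at this)
  rwa [h0, map_zero, map_zero, sub_zero, add_zero, add_zero, mul_one] at h

theorem Gr.one_sub_proj (P : Gr 𝕜 W p) : 1 - P.proj = P.adaptedFrame.projC := by
  rw [P.proj_eq, ← P.adaptedFrame.projB_add_projC, add_sub_cancel_left]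

section Maps

variable {E : Type*} [NormedAddCommGroup E] [NormedSpace ℝ E]
  {M : Type*} [TopologicalSpace M] [ChartedSpace E M]

/-- The orthogonal projections to the subspaces `f(y)`, in the chart at `x`. -/
def localProj (f : M → Gr 𝕜 W p) (x : M) (ξ : E) : W →L[ℝ] W :=
  (f ((extChartAt 𝓘(ℝ, E) x).symm ξ)).proj

/-- The map `f` written in the charts at `x` and `f x`. -/
abbrev localMap (f : M → Gr 𝕜 W p) (x : M) : E → Model 𝕜 W p :=
  writtenInExtChartAt 𝓘(ℝ, E) 𝓘(ℝ, Model 𝕜 W p) x f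

variable {f : M → Gr 𝕜 W p} {x : M}

theorem localProj_apply {y : M} (hy : y ∈ (extChartAt 𝓘(ℝ, E) x).source) :
    localProj (E := E) f x (extChartAt 𝓘(ℝ, E) x y) = (f y).proj := by
  rw [localProj, (extChartAt 𝓘(ℝ, E) x).left_inv hy]

omit [NormedSpace ℝ W] [IsScalarTower ℝ 𝕜 W] in
theorem localMap_self : localMap (E := E) f x (extChartAt 𝓘(ℝ, E) x x) = 0 := by
  change extChartAt 𝓘(ℝ, Model 𝕜 W p) (f x)
    (f ((extChartAt 𝓘(ℝ, E) x).symm (extChartAt 𝓘(ℝ, E) x x))) = 0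
  rw [extChartAt_to_inv]
  exact (f x).chart_self

/-- Continuity keeps `f` inside the graph chart at `f x`, where each value is the graph of its
coordinate and `AdaptedFrame.proj_graphFrame` applies. -/
theorem localProj_mul (hf : ContinuousAt f x) :
    ∀ᶠ ξ in 𝓝 (extChartAt 𝓘(ℝ, E) x x), localProj f x ξ *
      (1 + (f x).adaptedFrame.homR (localMap f x ξ) - (f x).adaptedFrame.homTR (localMap f x ξ)) =
        (f x).adaptedFrame.projB + (f x).adaptedFrame.homR (localMap f x ξ) := by
  have h1 : ContinuousAt (fun ξ => f ((extChartAt 𝓘(ℝ, E) x).symm ξ))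
      (extChartAt 𝓘(ℝ, E) x x) :=
    ContinuousAt.comp_of_eq hf (continuousAt_extChartAt_symm x) (extChartAt_to_inv x)
  have h2 : (f x).adaptedFrame.source ∈
      𝓝 (f ((extChartAt 𝓘(ℝ, E) x).symm (extChartAt 𝓘(ℝ, E) x x))) := by
    rw [extChartAt_to_inv]
    exact (chartAt (Model 𝕜 W p) (f x)).open_source.mem_nhds (mem_chart_source _ _)
  filter_upwards [h1.eventually h2] with ξ hξ
  have h3 := (f x).adaptedFrame.proj_graphFrame (localMap f x ξ)
  have h4 : Gr.mk ((f x).adaptedFrame.graphFrame (localMap f x ξ)) =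
      f ((extChartAt 𝓘(ℝ, E) x).symm ξ) := (f x).adaptedFrame.chart.left_inv hξ
  rwa [h4] at h3

omit [NormedSpace ℝ W] [IsScalarTower ℝ 𝕜 W] in
theorem contDiffAt_localMap
    (hf : ContMDiffAt 𝓘(ℝ, E) 𝓘(ℝ, Model 𝕜 W p) 2 f x) :
    ContDiffAt ℝ 2 (localMap (E := E) f x) (extChartAt 𝓘(ℝ, E) x x) := by
  have := (contMDiffAt_iff.1 hf).2
  rwa [ModelWithCorners.range_eq_univ, contDiffWithinAt_univ] at this

theorem contDiffAt_localProj
    (hf : ContMDiffAt 𝓘(ℝ, E) 𝓘(ℝ, Model 𝕜 W p) 2 f x) :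
    ContDiffAt ℝ 2 (localProj (E := E) f x) (extChartAt 𝓘(ℝ, E) x x) := by
  have : CompleteSpace W := FiniteDimensional.complete 𝕜 W
  refine contDiffAt_of_mul_eq (ContDiffAt.continuousLinearMap_comp _ (contDiffAt_localMap hf))
    (ContDiffAt.continuousLinearMap_comp _ (contDiffAt_localMap hf)) ?_ ?_
    (localProj_mul hf.continuousAt)
  · exact (congrArg _ localMap_self).trans (map_zero _)
  · exact (congrArg _ localMap_self).trans (map_zero _)

theorem localProj_self :
    localProj (E := E) f x (extChartAt 𝓘(ℝ, E) x x) = (f x).adaptedFrame.projB := by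
  rw [localProj_apply (mem_extChartAt_source x), Gr.proj_eq]

theorem fderiv_localProj
    (hf : ContMDiffAt 𝓘(ℝ, E) 𝓘(ℝ, Model 𝕜 W p) 2 f x) (u : E) :
    fderiv ℝ (localProj f x) (extChartAt 𝓘(ℝ, E) x x) u =
      (f x).adaptedFrame.homR (fderiv ℝ (localMap f x) (extChartAt 𝓘(ℝ, E) x x) u) +
      (f x).adaptedFrame.homTR (fderiv ℝ (localMap f x) (extChartAt 𝓘(ℝ, E) x x) u) :=
  fderiv_of_mul_clm_eq ((contDiffAt_localProj hf).differentiableAt two_ne_zero)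
    (contDiffAt_localMap hf) (localProj_mul hf.continuousAt) localMap_self localProj_self
    (AdaptedFrame.projB_mul_homR _) (AdaptedFrame.projB_mul_homTR _) u

/-- The derivatives enter through equations so that values already computed can be inserted, as is
done for the identity map of the Grassmannian. -/
theorem fderiv_fderiv_localProj
    (hf : ContMDiffAt 𝓘(ℝ, E) 𝓘(ℝ, Model 𝕜 W p) 2 f x) (u v : E) {Tu Tv Tuv : Model 𝕜 W p}
    (hTu : fderiv ℝ (localMap f x) (extChartAt 𝓘(ℝ, E) x x) u = Tu)
    (hTv : fderiv ℝ (localMap f x) (extChartAt 𝓘(ℝ, E) x x) v = Tv)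
    (hTuv : fderiv ℝ (fderiv ℝ (localMap f x)) (extChartAt 𝓘(ℝ, E) x x) u v = Tuv) :
    fderiv ℝ (fderiv ℝ (localProj f x)) (extChartAt 𝓘(ℝ, E) x x) u v =
      (f x).adaptedFrame.homR Tuv + (f x).adaptedFrame.homTR Tuv
        + (f x).adaptedFrame.homR Tu * (f x).adaptedFrame.homTR Tv
        - (f x).adaptedFrame.homTR Tu * (f x).adaptedFrame.homR Tv
        + (f x).adaptedFrame.homR Tv * (f x).adaptedFrame.homTR Tu
        - (f x).adaptedFrame.homTR Tv * (f x).adaptedFrame.homR Tu := by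
  subst hTu hTv hTuv
  exact fderiv_fderiv_of_mul_clm_eq (contDiffAt_localProj hf)
    (contDiffAt_localMap hf) (localProj_mul hf.continuousAt) localMap_self localProj_self
    (AdaptedFrame.projB_mul_homR _) (AdaptedFrame.projB_mul_homTR _)
    (AdaptedFrame.homR_mul_homR _) (AdaptedFrame.homTR_mul_homTR _) u v

end Maps

end Projections

/-! ### The block algebra behind the second covariant derivative -/

section Projections

/-- Only blocks with values in the span of `c` survive. The term `H_u H_v*` coming from the
derivative of the projection `1 - π` cancels one of the two such products in the second derivative
of `π`, and `H_v H_u*` remains. -/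
theorem AdaptedFrame.projC_mul_secondDeriv {𝕜 : Type*} [RCLike 𝕜] {W : Type*}
    [NormedAddCommGroup W] [InnerProductSpace 𝕜 W] [FiniteDimensional 𝕜 W] [NormedSpace ℝ W]
    [IsScalarTower ℝ 𝕜 W] {p q : ℕ} (F : AdaptedFrame 𝕜 W p q)
    (Tu Tv Tuv Tc : Coord 𝕜 p →L[𝕜] Coord 𝕜 q) :
    F.projC * ((F.homR Tu + F.homTR Tu) * (F.homR Tv + F.homTR Tv) -
      F.projC * (F.homR Tuv + F.homTR Tuv + F.homR Tu * F.homTR Tv - F.homTR Tu * F.homR Tv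
        + F.homR Tv * F.homTR Tu - F.homTR Tv * F.homR Tu))
      + F.projC * (F.homR Tc + F.homTR Tc) =
    -F.homR (Tuv - Tc) - F.homR Tv * F.homTR Tu := by
  simp only [mul_sub, mul_add, add_mul, ← mul_assoc, projC_mul_homR,
    projC_mul_homTR, homR_mul_homR, zero_mul, mul_zero, map_sub]
  abel

end Projections

/-! ### Covariant derivatives of the sections given by vectors of `W` -/

section Sections

open Filter Topology

variable {𝕜 : Type*} [RCLike 𝕜] {W : Type*} [NormedAddCommGroup W] [InnerProductSpace 𝕜 W]
  [FiniteDimensional 𝕜 W] {p : ℕ} {E : Type*} [NormedAddCommGroup E] [NormedSpace ℝ E]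
  {M : Type*} [TopologicalSpace M] [ChartedSpace E M] {f : M → Gr 𝕜 W p} {x : M}

theorem mfderiv_eq_fderiv_localMap
    (hf : ContMDiffAt 𝓘(ℝ, E) 𝓘(ℝ, Model 𝕜 W p) 2 f x) (u : TangentSpace 𝓘(ℝ, E) x) :
    mfderiv 𝓘(ℝ, E) 𝓘(ℝ, Model 𝕜 W p) f x u =
      fderiv ℝ (localMap f x) (extChartAt 𝓘(ℝ, E) x x) u := by
  rw [(hf.mdifferentiableAt two_ne_zero).mfderiv, ModelWithCorners.range_eq_univ,
    fderivWithin_univ]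
  rfl

variable [NormedSpace ℝ W] [IsScalarTower ℝ 𝕜 W]

/-- The homomorphism `S_P → Q_P` corresponding to a tangent vector at `P`, extended by zero. -/
def Gr.homR (P : Gr 𝕜 W p) : TangentSpace 𝓘(ℝ, Model 𝕜 W p) P →L[ℝ] (W →L[ℝ] W) :=
  P.adaptedFrame.homR

/-- The adjoint `Q_P → S_P` of `Gr.homR`, extended by zero. -/
def Gr.homTR (P : Gr 𝕜 W p) : TangentSpace 𝓘(ℝ, Model 𝕜 W p) P →L[ℝ] (W →L[ℝ] W) :=
  P.adaptedFrame.homTR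

omit [TopologicalSpace M] in
theorem coe_sectionOf_pullQuot (w : W) (y : M) :
    (sectionOf (pullQuot f) w y : W) = (1 - (f y).proj) w :=
  (f y).starProjection_quot w

omit [TopologicalSpace M] in
theorem coe_sectionOf_pullTaut (w : W) (y : M) :
    (sectionOf (pullTaut f) w y : W) = (f y).proj w := rfl

theorem coe_covDeriv_pullQuot (t : (y : M) → pullQuot f y) (y : M) (X : TangentSpace 𝓘(ℝ, E) y) :
    (covDeriv (pullQuot f) t y X : W) =
      (1 - (f y).proj) (mvfderiv 𝓘(ℝ, E) (fun z => (t z : W)) y X) :=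
  (f y).starProjection_quot _

theorem sectionOf_pullQuot_eq {y : M} (hy : y ∈ (extChartAt 𝓘(ℝ, E) x).source) (w : W) :
    (fun z => (sectionOf (pullQuot f) w z : W)) =ᶠ[𝓝 y]
      (fun ξ => (1 - localProj f x ξ) w) ∘ extChartAt 𝓘(ℝ, E) x := by
  filter_upwards [(isOpen_extChartAt_source x).mem_nhds hy] with z hz
  rw [Function.comp_apply, localProj_apply hz, coe_sectionOf_pullQuot]

theorem sectionOf_pullTaut_eq {y : M} (hy : y ∈ (extChartAt 𝓘(ℝ, E) x).source) (w : W) :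
    (fun z => (sectionOf (pullTaut f) w z : W)) =ᶠ[𝓝 y]
      (fun ξ => localProj f x ξ w) ∘ extChartAt 𝓘(ℝ, E) x := by
  filter_upwards [(isOpen_extChartAt_source x).mem_nhds hy] with z hz
  rw [Function.comp_apply, localProj_apply hz, coe_sectionOf_pullTaut]

variable [IsManifold 𝓘(ℝ, E) 1 M]

theorem mvfderiv_sectionOf_pullTaut (hf : ContMDiffAt 𝓘(ℝ, E) 𝓘(ℝ, Model 𝕜 W p) 2 f x)
    (w : W) (X : TangentSpace 𝓘(ℝ, E) x) :
    mvfderiv 𝓘(ℝ, E) (fun y => (sectionOf (pullTaut f) w y : W)) x X =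
      fderiv ℝ (localProj f x) (extChartAt 𝓘(ℝ, E) x x) X w := by
  have h := (((contDiffAt_localProj hf).differentiableAt two_ne_zero).hasFDerivAt).clm_apply
    (hasFDerivAt_const w _)
  rw [mvfderiv_eq_fderiv h.differentiableAt (sectionOf_pullTaut_eq (mem_extChartAt_source x) w),
    h.fderiv, ContinuousLinearMap.comp_zero, zero_add]
  rfl

theorem hasFDerivAt_one_sub_apply {S : E → W →L[ℝ] W} {ξ : E} (h : DifferentiableAt ℝ S ξ) (w : W) :
    HasFDerivAt (fun ξ => (1 - S ξ) w) (-((fderiv ℝ S ξ).flip w)) ξ :=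
  ((h.hasFDerivAt.const_sub 1).clm_apply (hasFDerivAt_const w _)).congr_fderiv (by ext; simp)

theorem mvfderiv_sectionOf_pullQuot (hf : ContMDiffAt 𝓘(ℝ, E) 𝓘(ℝ, Model 𝕜 W p) 2 f x)
    (w : W) (X : TangentSpace 𝓘(ℝ, E) x) :
    mvfderiv 𝓘(ℝ, E) (fun y => (sectionOf (pullQuot f) w y : W)) x X =
      -(fderiv ℝ (localProj f x) (extChartAt 𝓘(ℝ, E) x x) X w) := by
  have h := hasFDerivAt_one_sub_apply ((contDiffAt_localProj hf).differentiableAt two_ne_zero) w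
  rw [mvfderiv_eq_fderiv h.differentiableAt (sectionOf_pullQuot_eq (mem_extChartAt_source x) w),
    h.fderiv]
  rfl

/-- An identity of germs is required, since the result is differentiated again; it is available
because being `C²` at a point persists nearby. -/
theorem covDeriv_coordField_eq (hf : ContMDiffAt 𝓘(ℝ, E) 𝓘(ℝ, Model 𝕜 W p) 2 f x) (w : W)
    (v : E) :
    (fun y => (covDeriv (E := E) (pullQuot f) (sectionOf (pullQuot f) w) y
      (coordField x v y) : W)) =ᶠ[𝓝 x]
      (fun ξ => (1 - localProj f x ξ) (-(fderiv ℝ (localProj f x) ξ v w))) ∘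
        extChartAt 𝓘(ℝ, E) x := by
  have h1 : ∀ᶠ y in 𝓝 x, ContDiffAt ℝ 2 (localProj (E := E) f x) (extChartAt 𝓘(ℝ, E) x y) :=
    (continuousAt_extChartAt (I := 𝓘(ℝ, E)) x).eventually
      ((contDiffAt_localProj hf).eventually (by simp))
  filter_upwards [h1, extChartAt_source_mem_nhds (I := 𝓘(ℝ, E)) x] with y hy hy'
  have h := hasFDerivAt_one_sub_apply (hy.differentiableAt two_ne_zero) w
  have h2 := mvfderiv_coordField hy' h.differentiableAt (sectionOf_pullQuot_eq hy' w) v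
  rw [coe_covDeriv_pullQuot, ← localProj_apply hy']
  refine congrArg _ (h2.trans ?_)
  rw [h.fderiv]
  rfl

omit [IsManifold 𝓘(ℝ, E) 1 M] in
theorem projC_secondDeriv_localProj (hf : ContMDiffAt 𝓘(ℝ, E) 𝓘(ℝ, Model 𝕜 W p) 2 f x) (w : W)
    (u v a : E) :
    (1 - (f x).proj) (fderiv ℝ (localProj f x) (extChartAt 𝓘(ℝ, E) x x) u
        (fderiv ℝ (localProj f x) (extChartAt 𝓘(ℝ, E) x x) v w) -
        (1 - (f x).proj)
          (fderiv ℝ (fderiv ℝ (localProj f x)) (extChartAt 𝓘(ℝ, E) x x) u v w)) -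
      (1 - (f x).proj) (-(fderiv ℝ (localProj f x) (extChartAt 𝓘(ℝ, E) x x) a w)) =
    -(f x).adaptedFrame.homR
      (fderiv ℝ (fderiv ℝ (localMap f x)) (extChartAt 𝓘(ℝ, E) x x) u v -
        fderiv ℝ (localMap f x) (extChartAt 𝓘(ℝ, E) x x) a) w -
      (f x).adaptedFrame.homR (fderiv ℝ (localMap f x) (extChartAt 𝓘(ℝ, E) x x) v)
        ((f x).adaptedFrame.homTR (fderiv ℝ (localMap f x) (extChartAt 𝓘(ℝ, E) x x) u) w) := by
  have h := congrArg (fun L => L w) ((f x).adaptedFrame.projC_mul_secondDeriv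
    (fderiv ℝ (localMap f x) (extChartAt 𝓘(ℝ, E) x x) u)
    (fderiv ℝ (localMap f x) (extChartAt 𝓘(ℝ, E) x x) v)
    (fderiv ℝ (fderiv ℝ (localMap f x)) (extChartAt 𝓘(ℝ, E) x x) u v)
    (fderiv ℝ (localMap f x) (extChartAt 𝓘(ℝ, E) x x) a))
  rw [← fderiv_localProj hf, ← fderiv_localProj hf, ← fderiv_localProj hf,
    ← fderiv_fderiv_localProj hf u v rfl rfl rfl, ← Gr.one_sub_proj] at h
  refine Eq.trans ?_ h
  rw [map_neg, sub_neg_eq_add]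
  rfl

omit [IsManifold 𝓘(ℝ, E) 1 M] in
theorem fderiv_one_sub_localProj (hf : ContMDiffAt 𝓘(ℝ, E) 𝓘(ℝ, Model 𝕜 W p) 2 f x) (w : W)
    (u v : E) :
    HasFDerivAt (fun ξ => (1 - localProj f x ξ) (-(fderiv ℝ (localProj f x) ξ v w)))
      (fderiv ℝ (fun ξ => (1 - localProj f x ξ) (-(fderiv ℝ (localProj f x) ξ v w)))
        (extChartAt 𝓘(ℝ, E) x x)) (extChartAt 𝓘(ℝ, E) x x) ∧
    fderiv ℝ (fun ξ => (1 - localProj f x ξ) (-(fderiv ℝ (localProj f x) ξ v w)))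
      (extChartAt 𝓘(ℝ, E) x x) u =
      fderiv ℝ (localProj f x) (extChartAt 𝓘(ℝ, E) x x) u
        (fderiv ℝ (localProj f x) (extChartAt 𝓘(ℝ, E) x x) v w) -
      (1 - (f x).proj)
        (fderiv ℝ (fderiv ℝ (localProj f x)) (extChartAt 𝓘(ℝ, E) x x) u v w) := by
  have c := contDiffAt_localProj hf
  have d0 := ((c.differentiableAt two_ne_zero).hasFDerivAt).const_sub 1
  have d1 := ((hasFDerivAt_fderiv_apply c v).clm_apply (hasFDerivAt_const w _)).neg
  have d2 : HasFDerivAt (fun ξ => (1 - localProj f x ξ) (-(fderiv ℝ (localProj f x) ξ v w)))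
    _ _ := d0.clm_apply d1
  refine ⟨d2.differentiableAt.hasFDerivAt, ?_⟩
  rw [d2.fderiv, ← localProj_apply (E := E) (f := f) (mem_extChartAt_source x)]
  simp only [add_apply, ContinuousLinearMap.comp_apply, ContinuousLinearMap.flip_apply,
    neg_apply, map_neg, ContinuousLinearMap.comp_zero, zero_add, neg_neg]
  abel

variable [FiniteDimensional ℝ E] [RiemannianBundle (fun x : M => TangentSpace 𝓘(ℝ, E) x)]

/-- The first term is the part of the second fundamental form of `f` that excludes the connection of
the target, which will turn out to contribute nothing; the second becomes the mean curvature
operator after taking the trace. -/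
theorem coe_covHessian (hf : ContMDiffAt 𝓘(ℝ, E) 𝓘(ℝ, Model 𝕜 W p) 2 f x) (w : W)
    (u v : TangentSpace 𝓘(ℝ, E) x) :
    (covHessian (E := E) (pullQuot f) (sectionOf (pullQuot f) w) x u v : W) =
      -((f x).homR (secondDeriv f x u v -
        mfderiv 𝓘(ℝ, E) 𝓘(ℝ, Model 𝕜 W p) f x (christoffel x u v)) w)
      - (f x).homR (mfderiv 𝓘(ℝ, E) 𝓘(ℝ, Model 𝕜 W p) f x v)
        ((f x).homTR (mfderiv 𝓘(ℝ, E) 𝓘(ℝ, Model 𝕜 W p) f x u) w) := by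
  obtain ⟨h1, h2⟩ := fderiv_one_sub_localProj hf w u v
  have h3 := mvfderiv_eq_fderiv h1.differentiableAt (covDeriv_coordField_eq hf w v) u
  have h4 := mvfderiv_sectionOf_pullQuot hf w (christoffel x u v)
  have h5 : (covHessian (E := E) (pullQuot f) (sectionOf (pullQuot f) w) x u v : W) =
      (1 - (f x).proj) (fderiv ℝ (localProj f x) (extChartAt 𝓘(ℝ, E) x x) u
        (fderiv ℝ (localProj f x) (extChartAt 𝓘(ℝ, E) x x) v w) -
        (1 - (f x).proj)
          (fderiv ℝ (fderiv ℝ (localProj f x)) (extChartAt 𝓘(ℝ, E) x x) u v w)) -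
      (1 - (f x).proj) (-(fderiv ℝ (localProj f x) (extChartAt 𝓘(ℝ, E) x x)
        (christoffel x u v) w)) := by
    rw [covHessian, Submodule.coe_sub, coe_covDeriv_pullQuot, coe_covDeriv_pullQuot]
    exact congrArg₂ (fun a b => (1 - (f x).proj) a - (1 - (f x).proj) b) (h3.trans h2) h4
  refine h5.trans ((projC_secondDeriv_localProj hf w u v (christoffel x u v)).trans ?_)
  rw [mfderiv_eq_fderiv_localMap hf, mfderiv_eq_fderiv_localMap hf,
    mfderiv_eq_fderiv_localMap hf]
  rfl

end Sections

/-! ### The metric of the Grassmannian and its Christoffel symbols -/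

section Bilinear

theorem fderiv_bilin_fderiv {E R : Type*} [NormedAddCommGroup E] [NormedSpace ℝ E]
    [NormedAddCommGroup R] [NormedSpace ℝ R] (L : R →L[ℝ] R →L[ℝ] ℝ) {g : E → R} {ξ : E}
    (hg : ContDiffAt ℝ 2 g ξ) (u v w : E) :
    DifferentiableAt ℝ (fun η => L (fderiv ℝ g η u) (fderiv ℝ g η v) / 2) ξ ∧
    fderiv ℝ (fun η => L (fderiv ℝ g η u) (fderiv ℝ g η v) / 2) ξ w =
      (L (fderiv ℝ (fderiv ℝ g) ξ w u) (fderiv ℝ g ξ v) +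
        L (fderiv ℝ g ξ u) (fderiv ℝ (fderiv ℝ g) ξ w v)) / 2 := by
  have h := ((L.hasFDerivAt.comp ξ (hasFDerivAt_fderiv_apply hg u)).clm_apply
    (hasFDerivAt_fderiv_apply hg v)).mul_const (2 : ℝ)⁻¹
  simp only [div_eq_mul_inv]
  refine ⟨h.differentiableAt, (congrArg (fun L => L w) h.fderiv).trans ?_⟩
  simp
  ring

end Bilinear

section Metric

open Filter Topology

variable {𝕜 : Type*} [RCLike 𝕜] {W : Type*} [NormedAddCommGroup W] [InnerProductSpace 𝕜 W]
  [FiniteDimensional 𝕜 W] {p q : ℕ}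

theorem trace_eq_sum_inner_single {m : ℕ} (L : Coord 𝕜 m →ₗ[𝕜] Coord 𝕜 m) :
    LinearMap.trace 𝕜 _ L =
      ∑ i, inner 𝕜 (EuclideanSpace.single i 1) (L (EuclideanSpace.single i 1)) := by
  rw [LinearMap.trace_eq_sum_inner _ (EuclideanSpace.basisFun (Fin m) 𝕜)]
  simp only [EuclideanSpace.basisFun_apply]

/-- Cyclicity of the trace. It makes the two off-diagonal blocks of `H_X + H_X*` contribute equally,
whence the factor in `two_mul_form`, and it exchanges sums over `𝕜ᵖ` and `𝕜^q` in the energy. -/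
theorem sum_inner_adjoint (X Y : Coord 𝕜 p →L[𝕜] Coord 𝕜 q) :
    ∑ k, RCLike.re (inner 𝕜 (ContinuousLinearMap.adjoint X (EuclideanSpace.single k 1))
      (ContinuousLinearMap.adjoint Y (EuclideanSpace.single k 1))) =
    ∑ i, RCLike.re (inner 𝕜 (X (EuclideanSpace.single i 1)) (Y (EuclideanSpace.single i 1))) := by
  have h := congrArg RCLike.re (LinearMap.trace_comp_comm' (X : Coord 𝕜 p →ₗ[𝕜] Coord 𝕜 q)
    (ContinuousLinearMap.adjoint Y : Coord 𝕜 q →ₗ[𝕜] Coord 𝕜 p))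
  rw [trace_eq_sum_inner_single, trace_eq_sum_inner_single, map_sum, map_sum] at h
  simp only [LinearMap.comp_apply, ContinuousLinearMap.coe_coe,
    ContinuousLinearMap.adjoint_inner_right] at h
  simp only [ContinuousLinearMap.adjoint_inner_left]
  refine h.symm.trans (Finset.sum_congr rfl fun i _ => ?_)
  exact inner_re_symm ..

namespace AdaptedFrame

theorem trace_eq (F : AdaptedFrame 𝕜 W p q) (Z : W →ₗ[𝕜] W) :
    LinearMap.trace 𝕜 W Z =
      ∑ i, inner 𝕜 (F.bL (EuclideanSpace.single i 1)) (Z (F.bL (EuclideanSpace.single i 1))) +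
      ∑ k, inner 𝕜 (F.cL (EuclideanSpace.single k 1)) (Z (F.cL (EuclideanSpace.single k 1))) := by
  have h : Z = (Z ∘ₗ (F.bL : Coord 𝕜 p →ₗ[𝕜] W)) ∘ₗ (F.bT : W →ₗ[𝕜] Coord 𝕜 p) +
      (Z ∘ₗ (F.cL : Coord 𝕜 q →ₗ[𝕜] W)) ∘ₗ (F.cT : W →ₗ[𝕜] Coord 𝕜 q) := by
    ext w
    change Z w = Z (F.bL (F.bT w)) + Z (F.cL (F.cT w))
    rw [← map_add, F.decomp]
  conv_lhs => rw [h]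
  rw [map_add, LinearMap.trace_comp_comm' (F.bT : W →ₗ[𝕜] Coord 𝕜 p),
    LinearMap.trace_comp_comm' (F.cT : W →ₗ[𝕜] Coord 𝕜 q), trace_eq_sum_inner_single,
    trace_eq_sum_inner_single]
  congr 1 <;> refine Finset.sum_congr rfl fun i _ => ?_
  · exact F.inner_bT_right _ _
  · exact F.inner_cT_right _ _

variable [NormedSpace ℝ W] [IsScalarTower ℝ 𝕜 W]

/-- The real trace form `Re tr (A* B)`, computed in an adapted frame. -/
def traceForm (F : AdaptedFrame 𝕜 W p q) : (W →L[ℝ] W) →L[ℝ] (W →L[ℝ] W) →L[ℝ] ℝ :=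
  haveI : FiniteDimensional ℝ W := Module.Finite.trans 𝕜 W
  LinearMap.toContinuousBilinearMap (LinearMap.mk₂ ℝ (fun A B =>
    ∑ i, RCLike.re (inner 𝕜 (A (F.bL (EuclideanSpace.single i 1)))
      (B (F.bL (EuclideanSpace.single i 1)))) +
    ∑ k, RCLike.re (inner 𝕜 (A (F.cL (EuclideanSpace.single k 1)))
      (B (F.cL (EuclideanSpace.single k 1)))))
    (fun A A' B => by
      simp only [add_apply, inner_add_left, map_add, Finset.sum_add_distrib]
      ring)
    (fun r A B => by
      simp only [smul_apply, RCLike.real_smul_eq_coe_smul (K := 𝕜) r, inner_smul_left,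
        RCLike.conj_ofReal, RCLike.re_ofReal_mul, ← Finset.mul_sum, ← mul_add, smul_eq_mul])
    (fun A B B' => by
      simp only [add_apply, inner_add_right, map_add, Finset.sum_add_distrib]
      ring)
    (fun r A B => by
      simp only [smul_apply, RCLike.real_smul_eq_coe_smul (K := 𝕜) r, inner_smul_right,
        RCLike.re_ofReal_mul, ← Finset.mul_sum, ← mul_add, smul_eq_mul]))

theorem traceForm_apply (F : AdaptedFrame 𝕜 W p q) (A B : W →L[ℝ] W) :
    F.traceForm A B = ∑ i, RCLike.re (inner 𝕜 (A (F.bL (EuclideanSpace.single i 1)))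
      (B (F.bL (EuclideanSpace.single i 1)))) +
    ∑ k, RCLike.re (inner 𝕜 (A (F.cL (EuclideanSpace.single k 1)))
      (B (F.cL (EuclideanSpace.single k 1)))) := rfl

/-- The right-hand side does not involve `F`, so on `𝕜`-linear operators the form is independent of
the frame. -/
theorem traceForm_restrictScalars (F : AdaptedFrame 𝕜 W p q) (A B : W →L[𝕜] W) :
    F.traceForm (A.restrictScalars ℝ) (B.restrictScalars ℝ) = RCLike.re (LinearMap.trace 𝕜 W
      (LinearMap.adjoint (A : W →ₗ[𝕜] W) ∘ₗ (B : W →ₗ[𝕜] W))) := by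
  rw [F.trace_eq, map_add, map_sum, map_sum, traceForm_apply]
  simp only [LinearMap.comp_apply, LinearMap.adjoint_inner_right]
  rfl

theorem traceForm_symm (F : AdaptedFrame 𝕜 W p q) (A B : W →L[ℝ] W) :
    F.traceForm A B = F.traceForm B A := by
  rw [traceForm_apply, traceForm_apply]
  congr 1 <;> exact Finset.sum_congr rfl fun i _ => inner_re_symm ..

/-- Two frames are allowed because the metric at a moving point uses the frame `F'` chosen there,
whereas differentiation needs one fixed bilinear form on operators. -/
theorem two_mul_form (F F' : AdaptedFrame 𝕜 W p q) (X Y : Coord 𝕜 p →L[𝕜] Coord 𝕜 q) :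
    2 * F'.form X Y = F.traceForm (F'.homR X + F'.homTR X) (F'.homR Y + F'.homTR Y) := by
  have h : F.traceForm (F'.homR X + F'.homTR X) (F'.homR Y + F'.homTR Y) =
      F'.traceForm (F'.homR X + F'.homTR X) (F'.homR Y + F'.homTR Y) :=
    (F.traceForm_restrictScalars (F'.hom X + F'.homT X) (F'.hom Y + F'.homT Y)).trans
      (F'.traceForm_restrictScalars (F'.hom X + F'.homT X) (F'.hom Y + F'.homT Y)).symm
  rw [h, traceForm_apply]
  simp only [add_apply, homR_apply, homTR_apply, bT_b, cT_b, bT_c, cT_c, map_zero, add_zero,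
    zero_add]
  have h1 : ∀ x y, inner 𝕜 (F'.bL x) (F'.bL y) = inner 𝕜 x y := F'.b.inner_map_map
  have h2 : ∀ x y, inner 𝕜 (F'.cL x) (F'.cL y) = inner 𝕜 x y := F'.c.inner_map_map
  simp only [h1, h2, sum_inner_adjoint, form_eq]
  ring

/-- The left operator is block diagonal, the right one off-diagonal, and such operators are
orthogonal for the trace form. -/
theorem traceForm_eq_zero (F : AdaptedFrame 𝕜 W p q) (X Y Z : Coord 𝕜 p →L[𝕜] Coord 𝕜 q) :
    F.traceForm (F.homR X * F.homTR Y - F.homTR X * F.homR Y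
      + F.homR Y * F.homTR X - F.homTR Y * F.homR X) (F.homR Z + F.homTR Z) = 0 := by
  have h1 : ∀ x y, inner 𝕜 (F.bL x) (F.cL y) = 0 := F.inner_b_c
  have h2 : ∀ x y, inner 𝕜 (F.cL x) (F.bL y) = 0 := fun x y => inner_eq_zero_symm.1 (h1 y x)
  rw [traceForm_apply]
  simp only [add_apply, sub_apply, mul_apply_eq_comp, homR_apply, homTR_apply, bT_b,
    cT_b, bT_c, cT_c, map_zero, add_zero, zero_add, sub_zero, zero_sub, inner_sub_left,
    inner_add_left, inner_neg_left, h1, h2, neg_zero, Finset.sum_const_zero]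

end AdaptedFrame

instance : IsManifold 𝓘(ℝ, Model 𝕜 W p) 1 (Gr 𝕜 W p) :=
  IsManifold.of_le (n := ∞) (by simp)

/-- The graph chart is onto the whole model space, so the equality is global and its derivatives are
immediate. -/
theorem localMap_id (P : Gr 𝕜 W p) :
    localMap (E := Model 𝕜 W p) (id : Gr 𝕜 W p → Gr 𝕜 W p) P = id :=
  funext fun T => P.adaptedFrame.chart.right_inv (Set.mem_univ T)

theorem contMDiffAt_two_id (P : Gr 𝕜 W p) :
    ContMDiffAt 𝓘(ℝ, Model 𝕜 W p) 𝓘(ℝ, Model 𝕜 W p) 2 (id : Gr 𝕜 W p → Gr 𝕜 W p) P :=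
  contMDiffAt_id

variable [NormedSpace ℝ W] [IsScalarTower ℝ 𝕜 W]

theorem Gr.fderiv_localProj_id (P : Gr 𝕜 W p) (u : Model 𝕜 W p) :
    fderiv ℝ (localProj (id : Gr 𝕜 W p → Gr 𝕜 W p) P)
      (extChartAt 𝓘(ℝ, Model 𝕜 W p) P P) u =
      P.adaptedFrame.homR u + P.adaptedFrame.homTR u := by
  have h := fderiv_localProj (contMDiffAt_two_id P) u
  rw [localMap_id, fderiv_id] at h
  exact h

theorem Gr.fderiv_fderiv_localProj_id (P : Gr 𝕜 W p) (u v : Model 𝕜 W p) :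
    fderiv ℝ (fderiv ℝ (localProj (id : Gr 𝕜 W p → Gr 𝕜 W p) P))
      (extChartAt 𝓘(ℝ, Model 𝕜 W p) P P) u v =
      P.adaptedFrame.homR u * P.adaptedFrame.homTR v - P.adaptedFrame.homTR u *
        P.adaptedFrame.homR v + P.adaptedFrame.homR v * P.adaptedFrame.homTR u -
        P.adaptedFrame.homTR v * P.adaptedFrame.homR u := by
  have h1 : ∀ u, fderiv ℝ (localMap (E := Model 𝕜 W p) (id : Gr 𝕜 W p → Gr 𝕜 W p) P)
      (extChartAt 𝓘(ℝ, Model 𝕜 W p) P P) u = u := fun u => by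
    rw [localMap_id, fderiv_id]
    rfl
  have h2 : fderiv ℝ (fderiv ℝ (localMap (E := Model 𝕜 W p) (id : Gr 𝕜 W p → Gr 𝕜 W p) P))
      (extChartAt 𝓘(ℝ, Model 𝕜 W p) P P) u v = 0 := by
    have h3 : fderiv ℝ (id : Model 𝕜 W p → Model 𝕜 W p) =
        fun _ => ContinuousLinearMap.id ℝ (Model 𝕜 W p) := funext fun _ => fderiv_id
    rw [localMap_id, h3, fderiv_fun_const]
    rfl
  have h := fderiv_fderiv_localProj (contMDiffAt_two_id P) u v (h1 u) (h1 v) h2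
  rw [map_zero, map_zero, add_zero, zero_add] at h
  exact h

theorem Gr.mvfderiv_proj (P : Gr 𝕜 W p) (X : TangentSpace 𝓘(ℝ, Model 𝕜 W p) P) :
    mvfderiv 𝓘(ℝ, Model 𝕜 W p) (Gr.proj : Gr 𝕜 W p → W →L[ℝ] W) P X =
      P.homR X + P.homTR X := by
  have h := contDiffAt_localProj (contMDiffAt_two_id P)
  refine (mvfderiv_eq_fderiv (h.differentiableAt two_ne_zero) ?_ X).trans
    (P.fderiv_localProj_id X)
  filter_upwards [extChartAt_source_mem_nhds (I := 𝓘(ℝ, Model 𝕜 W p)) P] with Q hQ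
  exact (localProj_apply (f := id) hQ).symm

/-- The metric of the Grassmannian in the chart at `P`. -/
theorem Gr.coordMetric_eq (P : Gr 𝕜 W p) (u v : Model 𝕜 W p) :
    coordMetric (E := Model 𝕜 W p) P u v =ᶠ[𝓝 P]
      (fun T => P.adaptedFrame.traceForm
        (fderiv ℝ (localProj (id : Gr 𝕜 W p → Gr 𝕜 W p) P) T u)
        (fderiv ℝ (localProj (id : Gr 𝕜 W p → Gr 𝕜 W p) P) T v) / 2) ∘
        extChartAt 𝓘(ℝ, Model 𝕜 W p) P := by
  have h1 : ∀ᶠ Q in 𝓝 P, ContDiffAt ℝ 2 (localProj (E := Model 𝕜 W p) id P)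
      (extChartAt 𝓘(ℝ, Model 𝕜 W p) P Q) :=
    (continuousAt_extChartAt (I := 𝓘(ℝ, Model 𝕜 W p)) P).eventually
      ((contDiffAt_localProj (contMDiffAt_two_id P)).eventually (by simp))
  filter_upwards [h1, extChartAt_source_mem_nhds (I := 𝓘(ℝ, Model 𝕜 W p)) P] with Q h hQ
  -- The differential of `Gr.proj` at `Q` along `∂_u` is computed twice, in the chart at `Q` and in
  -- the chart at `P`; no transition map has to be differentiated.
  have h2 : ∀ u : Model 𝕜 W p,
      Q.adaptedFrame.homR (coordField (E := Model 𝕜 W p) P u Q) +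
        Q.adaptedFrame.homTR (coordField (E := Model 𝕜 W p) P u Q) =
      fderiv ℝ (localProj (id : Gr 𝕜 W p → Gr 𝕜 W p) P)
        (extChartAt 𝓘(ℝ, Model 𝕜 W p) P Q) u := fun u => by
    refine (Q.mvfderiv_proj _).symm.trans
      (mvfderiv_coordField hQ (h.differentiableAt two_ne_zero) ?_ u)
    filter_upwards [(isOpen_extChartAt_source P).mem_nhds hQ] with R hR
    exact (localProj_apply (f := id) hR).symm
  change Q.adaptedFrame.form (coordField (E := Model 𝕜 W p) P u Q)
    (coordField (E := Model 𝕜 W p) P v Q) = P.adaptedFrame.traceForm _ _ / 2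
  refine (eq_div_iff two_ne_zero).2 ((mul_comm _ _).trans ?_)
  exact (AdaptedFrame.two_mul_form P.adaptedFrame Q.adaptedFrame
    (coordField (E := Model 𝕜 W p) P u Q) (coordField (E := Model 𝕜 W p) P v Q)).trans
    (congrArg₂ (fun A B => P.adaptedFrame.traceForm A B) (h2 u) (h2 v))

theorem Gr.mvfderiv_coordMetric (P : Gr 𝕜 W p) (u v w : Model 𝕜 W p) :
    mvfderiv 𝓘(ℝ, Model 𝕜 W p) (coordMetric (E := Model 𝕜 W p) P u v) P w = 0 := by
  have c := contDiffAt_localProj (contMDiffAt_two_id P)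
  obtain ⟨d1, d2⟩ := fderiv_bilin_fderiv P.adaptedFrame.traceForm c u v w
  refine (mvfderiv_eq_fderiv d1 (P.coordMetric_eq u v) w).trans (d2.trans ?_)
  rw [P.fderiv_fderiv_localProj_id, P.fderiv_fderiv_localProj_id, P.fderiv_localProj_id,
    P.fderiv_localProj_id, AdaptedFrame.traceForm_eq_zero, AdaptedFrame.traceForm_symm,
    AdaptedFrame.traceForm_eq_zero, add_zero, zero_div]

/-- The Christoffel symbols of the Grassmannian vanish at the centre of each graph chart. -/
theorem Gr.christoffel_eq_zero (P : Gr 𝕜 W p) (u v : TangentSpace 𝓘(ℝ, Model 𝕜 W p) P) :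
    christoffel P u v = 0 := by
  have h : ∀ w, christoffelForm P u v w = 0 := fun w => by
    have h1 : christoffelForm P u v w = (0 + 0 - 0) / 2 :=
      congrArg (· / 2) (congrArg₂ (· - ·) (congrArg₂ (· + ·) (P.mvfderiv_coordMetric v w u)
        (P.mvfderiv_coordMetric u w v)) (P.mvfderiv_coordMetric u v w))
    rw [h1]
    norm_num
  rw [christoffel]
  exact Finset.sum_eq_zero fun i _ => by rw [h, zero_smul]

end Metric

/-! ### Rank of the quotient bundle and the trace identity for the energy -/

section Frames

variable {𝕜 : Type*} [RCLike 𝕜] {W : Type*} [NormedAddCommGroup W] [InnerProductSpace 𝕜 W]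
  [FiniteDimensional 𝕜 W] {p q : ℕ}

omit [FiniteDimensional 𝕜 W] in
theorem AdaptedFrame.quot_eq (F : AdaptedFrame 𝕜 W p q) {P : Gr 𝕜 W p} (h : F.point = P) :
    P.quot = LinearMap.range F.c.toLinearMap := by
  subst h
  exact F.range_c.symm

theorem Gr.quot_eq (P : Gr 𝕜 W p) : P.quot = LinearMap.range P.adaptedFrame.c.toLinearMap :=
  P.adaptedFrame.quot_eq P.adaptedFrame_point

theorem Gr.finrank_quot (P : Gr 𝕜 W p) :
    Module.finrank 𝕜 P.quot = Module.finrank 𝕜 W - p := by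
  rw [P.quot_eq, LinearMap.finrank_range_of_inj P.adaptedFrame.c.injective,
    finrank_euclideanSpace_fin]

theorem Gr.norm_sq_eq (P : Gr 𝕜 W p) (X : TangentSpace 𝓘(ℝ, Model 𝕜 W p) P) :
    ‖X‖ ^ 2 = P.adaptedFrame.form X X :=
  (real_inner_self_eq_norm_sq X).symm

variable [NormedSpace ℝ W] [IsScalarTower ℝ 𝕜 W]

theorem AdaptedFrame.homTR_mul_projC (F : AdaptedFrame 𝕜 W p q)
    (X : Coord 𝕜 p →L[𝕜] Coord 𝕜 q) : F.homTR X * F.projC = F.homTR X := by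
  ext w
  change F.bL (ContinuousLinearMap.adjoint X (F.cT (F.cL (F.cT w)))) = _
  rw [F.cT_c]
  rfl

/-- Vectors in the span of `b` suffice as tests; this lets the sections coming from `w ∈ U` detect
the tension field. -/
theorem AdaptedFrame.homR_injective (F : AdaptedFrame 𝕜 W p q)
    {X : Coord 𝕜 p →L[𝕜] Coord 𝕜 q} (h : ∀ a, F.homR X (F.bL a) = 0) : X = 0 := by
  ext1 a
  have h1 := h a
  rw [F.homR_apply, F.bT_b] at h1
  exact F.c.injective (h1.trans (map_zero F.cL).symm)

omit [FiniteDimensional 𝕜 W] [NormedSpace ℝ W] [IsScalarTower ℝ 𝕜 W] in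
-- Pairing the eigenvalue equation with `c e` gives `h = ∑ |X_i* e|²`. In particular the eigenvalue,
-- a priori in `𝕜`, is real.
theorem AdaptedFrame.sum_norm_sq_eq (F : AdaptedFrame 𝕜 W p q) {ι : Type*} [Fintype ι]
    (X : ι → Coord 𝕜 p →L[𝕜] Coord 𝕜 q) (h : 𝕜) (e : Coord 𝕜 q) (he : ‖e‖ = 1)
    (hX : ∑ i, F.cL (X i (ContinuousLinearMap.adjoint (X i) e)) = h • F.cL e) :
    ((∑ i, RCLike.re (inner 𝕜 (ContinuousLinearMap.adjoint (X i) e)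
      (ContinuousLinearMap.adjoint (X i) e)) : ℝ) : 𝕜) = h := by
  have h1 : ∀ x y, inner 𝕜 (F.cL x) (F.cL y) = inner 𝕜 x y := F.c.inner_map_map
  have h2 := congrArg (inner 𝕜 (F.cL e)) hX
  rw [inner_sum, inner_smul_right, h1, inner_self_eq_norm_sq_to_K, he, RCLike.ofReal_one,
    one_pow, mul_one] at h2
  rw [RCLike.ofReal_sum, ← h2]
  refine Finset.sum_congr rfl fun i _ => ?_
  rw [inner_self_ofReal_re, h1, ContinuousLinearMap.adjoint_inner_left]

/-- The eigenvalue of `∑ X_i X_i*` if this operator is a multiple of the identity. -/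
theorem AdaptedFrame.sum_form_eq (F : AdaptedFrame 𝕜 W p q) {ι : Type*} [Fintype ι]
    (X : ι → Coord 𝕜 p →L[𝕜] Coord 𝕜 q) (h : 𝕜)
    (hX : ∀ y, ∑ i, F.homR (X i) (F.homTR (X i) (F.cL y)) = h • F.cL y) :
    ((∑ i, F.form (X i) (X i) : ℝ) : 𝕜) = (q : 𝕜) * h := by
  have h1 : ∀ y, ∑ i, F.cL (X i (ContinuousLinearMap.adjoint (X i) y)) = h • F.cL y := fun y => by
    rw [← hX y]
    refine Finset.sum_congr rfl fun i _ => ?_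
    rw [homR_apply, homTR_apply, F.bT_b, F.cT_c]
  -- Passing to adjoints moves the inner sum to the basis of `𝕜^q`, each vector of which contributes
  -- `h`.
  have h2 : ∑ i, F.form (X i) (X i) = ∑ k : Fin q, ∑ i, RCLike.re (inner 𝕜
      (ContinuousLinearMap.adjoint (X i) (EuclideanSpace.single k 1))
      (ContinuousLinearMap.adjoint (X i) (EuclideanSpace.single k 1))) := by
    rw [Finset.sum_comm]
    refine Finset.sum_congr rfl fun i _ => ?_
    rw [form_eq, sum_inner_adjoint]
  have h3 : ∀ k : Fin q, ‖(EuclideanSpace.single k 1 : Coord 𝕜 q)‖ = 1 := fun k => by simp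
  rw [h2, RCLike.ofReal_sum]
  refine (Finset.sum_congr rfl fun k _ => F.sum_norm_sq_eq X h _ (h3 k) (h1 _)).trans ?_
  rw [Finset.sum_const, Finset.card_univ, Fintype.card_fin, nsmul_eq_mul]

end Frames

/-! ### Second fundamental forms, the Laplacian of `f^*Q`, and the equivalence -/

section Maps

variable {𝕜 : Type*} [RCLike 𝕜] {W : Type*} [NormedAddCommGroup W] [InnerProductSpace 𝕜 W]
  [FiniteDimensional 𝕜 W] {p : ℕ} {E : Type*} [NormedAddCommGroup E] [NormedSpace ℝ E]
  {M : Type*} [TopologicalSpace M] [ChartedSpace E M] {f : M → Gr 𝕜 W p} {x : M}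
  [NormedSpace ℝ W] [IsScalarTower ℝ 𝕜 W] [IsManifold 𝓘(ℝ, E) 1 M]

omit [IsManifold 𝓘(ℝ, E) 1 M] in
theorem fderiv_localProj_eq (hf : ContMDiffAt 𝓘(ℝ, E) 𝓘(ℝ, Model 𝕜 W p) 2 f x)
    (X : TangentSpace 𝓘(ℝ, E) x) :
    fderiv ℝ (localProj f x) (extChartAt 𝓘(ℝ, E) x x) X =
      (f x).homR (mfderiv 𝓘(ℝ, E) 𝓘(ℝ, Model 𝕜 W p) f x X) +
      (f x).homTR (mfderiv 𝓘(ℝ, E) 𝓘(ℝ, Model 𝕜 W p) f x X) := by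
  rw [mfderiv_eq_fderiv_localMap hf]
  exact fderiv_localProj hf X

theorem coe_formH (hf : ContMDiffAt 𝓘(ℝ, E) 𝓘(ℝ, Model 𝕜 W p) 2 f x)
    (X : TangentSpace 𝓘(ℝ, E) x) (u : pullTaut f x) :
    (formH f x X u : W) = (f x).homR (mfderiv 𝓘(ℝ, E) 𝓘(ℝ, Model 𝕜 W p) f x X) u := by
  have h : (formH f x X u : W) = (1 - (f x).proj)
      (mvfderiv 𝓘(ℝ, E) (fun y => (sectionOf (pullTaut f) (u : W) y : W)) x X) :=
    (f x).starProjection_quot _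
  rw [h, mvfderiv_sectionOf_pullTaut hf, fderiv_localProj_eq hf, Gr.one_sub_proj]
  have h1 := (f x).adaptedFrame.projC_mul_homR (mfderiv 𝓘(ℝ, E) 𝓘(ℝ, Model 𝕜 W p) f x X)
  have h2 := (f x).adaptedFrame.projC_mul_homTR (mfderiv 𝓘(ℝ, E) 𝓘(ℝ, Model 𝕜 W p) f x X)
  have h3 := congrArg₂ (fun A B => A (u : W) + B (u : W)) h1 h2
  refine (map_add (f x).adaptedFrame.projC _ _).trans (h3.trans ?_)
  exact add_zero _

/-- Sections of `V` come from `1 - π`, whose derivative is `-(H + H*)`; the projection to `U` keeps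
`-H*`. -/
theorem coe_formK (hf : ContMDiffAt 𝓘(ℝ, E) 𝓘(ℝ, Model 𝕜 W p) 2 f x)
    (X : TangentSpace 𝓘(ℝ, E) x) (v : pullQuot f x) :
    (formK f x X v : W) = -(f x).homTR (mfderiv 𝓘(ℝ, E) 𝓘(ℝ, Model 𝕜 W p) f x X) v := by
  have h : (formK f x X v : W) = (f x).proj
      (mvfderiv 𝓘(ℝ, E) (fun y => (sectionOf (pullQuot f) (v : W) y : W)) x X) := by
    refine ((pullQuot f x).starProjection_orthogonal_val _).trans ?_
    refine (congrArg (_ - ·) ((f x).starProjection_quot _)).trans ?_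
    exact sub_sub_cancel _ _
  rw [h, mvfderiv_sectionOf_pullQuot hf, fderiv_localProj_eq hf, Gr.proj_eq, map_neg]
  have h1 := (f x).adaptedFrame.projB_mul_homR (mfderiv 𝓘(ℝ, E) 𝓘(ℝ, Model 𝕜 W p) f x X)
  have h2 := (f x).adaptedFrame.projB_mul_homTR (mfderiv 𝓘(ℝ, E) 𝓘(ℝ, Model 𝕜 W p) f x X)
  have h3 := congrArg₂ (fun A B => A (v : W) + B (v : W)) h1 h2
  refine congrArg Neg.neg ((map_add (f x).adaptedFrame.projB _ _).trans (h3.trans ?_))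
  exact zero_add _

variable [FiniteDimensional ℝ E] [RiemannianBundle (fun x : M => TangentSpace 𝓘(ℝ, E) x)]

theorem coe_meanCurvatureOperator (hf : ContMDiffAt 𝓘(ℝ, E) 𝓘(ℝ, Model 𝕜 W p) 2 f x)
    (v : pullQuot f x) :
    (meanCurvatureOperator E f x v : W) =
      -∑ i, (f x).homR (mfderiv 𝓘(ℝ, E) 𝓘(ℝ, Model 𝕜 W p) f x (onb (E := E) x i))
        ((f x).homTR (mfderiv 𝓘(ℝ, E) 𝓘(ℝ, Model 𝕜 W p) f x (onb (E := E) x i)) v) := by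
  rw [meanCurvatureOperator, Submodule.coe_sum, ← Finset.sum_neg_distrib]
  refine Finset.sum_congr rfl fun i _ => ?_
  rw [coe_formH hf, coe_formK hf, map_neg]

omit [IsManifold 𝓘(ℝ, E) 1 M] in
theorem tensionField_eq :
    tensionField E (Model 𝕜 W p) f x = ∑ i, (secondDeriv f x (onb (E := E) x i) (onb x i) -
      mfderiv 𝓘(ℝ, E) 𝓘(ℝ, Model 𝕜 W p) f x (christoffel x (onb (E := E) x i) (onb x i))) := by
  rw [tensionField]
  refine Finset.sum_congr rfl fun i _ => ?_
  rw [secondFundamentalForm, Gr.christoffel_eq_zero, add_zero]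

/-- The trace of the covariant Hessian separates into the tension field, acting on `U`, and the mean
curvature operator, acting on `V`. -/
theorem coe_bundleLaplacian (hf : ContMDiffAt 𝓘(ℝ, E) 𝓘(ℝ, Model 𝕜 W p) 2 f x) (w : W) :
    (bundleLaplacian E (pullQuot f) (sectionOf (pullQuot f) w) x : W) =
      (f x).homR (tensionField E (Model 𝕜 W p) f x) w -
      meanCurvatureOperator E f x (sectionOf (pullQuot f) w x) := by
  -- `H*` vanishes on `U`, so `w` may be replaced by its projection to `V`.
  have h : ∀ X : Model 𝕜 W p, (f x).adaptedFrame.homTR X (sectionOf (pullQuot f) w x : W) =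
      (f x).adaptedFrame.homTR X w := fun X => by
    rw [coe_sectionOf_pullQuot, Gr.one_sub_proj]
    exact congrArg (fun L => L w) ((f x).adaptedFrame.homTR_mul_projC X)
  rw [bundleLaplacian, Submodule.coe_neg, Submodule.coe_sum, coe_meanCurvatureOperator hf,
    tensionField_eq, map_sum, sum_apply, sub_neg_eq_add, ← Finset.sum_add_distrib,
    ← Finset.sum_neg_distrib]
  refine Finset.sum_congr rfl fun i _ => ?_
  rw [coe_covHessian hf, neg_sub, sub_neg_eq_add, add_comm]
  exact congrArg (_ + (f x).homR _ ·) (h _).symm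

/-- Harmonic maps with mean curvature operator `-h Id` satisfy `Δ t = h t`, and conversely. -/
theorem harmonic_and_hasMeanCurvature_iff (hf : ContMDiff 𝓘(ℝ, E) 𝓘(ℝ, Model 𝕜 W p) 2 f)
    (h : M → 𝕜) :
    IsHarmonic E (Model 𝕜 W p) f ∧ HasMeanCurvature E f h ↔ SatisfiesLaplace E f h := by
  constructor
  · rintro ⟨h1, h2⟩ w x
    refine Subtype.ext ?_
    rw [coe_bundleLaplacian (hf x), h1 x, h2, map_zero]
    exact (zero_sub _).trans (neg_neg _)
  · intro h0
    have key : ∀ x w, (f x).homR (tensionField E (Model 𝕜 W p) f x) w -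
        meanCurvatureOperator E f x (sectionOf (pullQuot f) w x) =
        ((h x • sectionOf (pullQuot f) w x : pullQuot f x) : W) := fun x w => by
      rw [← coe_bundleLaplacian (hf x), h0]
    have h1 : IsHarmonic E (Model 𝕜 W p) f := fun x => by
      refine (f x).adaptedFrame.homR_injective fun a => ?_
      -- For `w` in `U_x` the section vanishes at `x`, so only the tension term of the Laplacian is
      -- left.
      have h2 : sectionOf (pullQuot f) ((f x).adaptedFrame.bL a) x = 0 := Subtype.ext <| by
        rw [coe_sectionOf_pullQuot, Gr.one_sub_proj, AdaptedFrame.projC_apply, AdaptedFrame.cT_b,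
          map_zero]
        rfl
      have h3 := key x ((f x).adaptedFrame.bL a)
      rw [h2, coe_meanCurvatureOperator (hf x), smul_zero] at h3
      simp only [Submodule.coe_zero, map_zero, Finset.sum_const_zero, neg_zero, sub_zero] at h3
      exact h3
    refine ⟨h1, fun x v => Subtype.ext ?_⟩
    -- For `w = v` in `V_x` the section has value `v` at `x`, and harmonicity removes the tension
    -- term.
    have h2 : sectionOf (pullQuot f) (v : W) x = v :=
      Subtype.ext (Submodule.starProjection_eq_self_iff.2 v.2)
    have h3 := key x v
    rw [h1 x, h2, map_zero] at h3
    exact neg_eq_iff_eq_neg.1 ((zero_sub _).symm.trans h3)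

theorem energyDensity_eq (hf : ContMDiff 𝓘(ℝ, E) 𝓘(ℝ, Model 𝕜 W p) 2 f) {h : M → 𝕜}
    (hA : HasMeanCurvature E f h) (x : M) :
    (energyDensity E (Model 𝕜 W p) f x : 𝕜) = (Module.finrank 𝕜 (pullQuot f x) : 𝕜) * h x := by
  have h1 : Module.finrank 𝕜 (pullQuot f x) = Module.finrank 𝕜 W - p := (f x).finrank_quot
  rw [h1, energyDensity]
  simp only [Gr.norm_sq_eq]
  refine (f x).adaptedFrame.sum_form_eq _ (h x) fun y => ?_
  have hy : (f x).adaptedFrame.cL y ∈ pullQuot f x := by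
    change _ ∈ (f x).quot
    rw [Gr.quot_eq]
    exact ⟨y, rfl⟩
  have h2 := congrArg Subtype.val (hA x ⟨_, hy⟩)
  rw [coe_meanCurvatureOperator (hf x)] at h2
  exact neg_inj.1 h2

omit [NormedSpace ℝ W] [IsScalarTower ℝ 𝕜 W] [IsManifold 𝓘(ℝ, E) 1 M] in
theorem energyDensity_of_isIsometricImmersion
    (hf : IsIsometricImmersion E (Model 𝕜 W p) f) (x : M) :
    energyDensity E (Model 𝕜 W p) f x = Module.finrank ℝ E := by
  have h1 : ∀ i, ‖mfderiv 𝓘(ℝ, E) 𝓘(ℝ, Model 𝕜 W p) f x (onb (E := E) x i)‖ ^ 2 = 1 := fun i => by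
    rw [← real_inner_self_eq_norm_sq, hf x, real_inner_self_eq_norm_sq]
    have h2 : ‖onb (E := E) x i‖ = 1 := (onb (E := E) x).orthonormal.1 i
    rw [h2, one_pow]
  rw [energyDensity, Finset.sum_congr rfl fun i _ => h1 i, Finset.sum_const, Finset.card_univ,
    Fintype.card_fin, nsmul_eq_mul, mul_one]
  rfl

end Maps

end Grassmann

end

/-! ### The generalized Takahashi theorem -/

theorem mainTheorem2 {𝕜 : Type*} [RCLike 𝕜] {W : Type*} [NormedAddCommGroup W]
    [InnerProductSpace 𝕜 W] [FiniteDimensional 𝕜 W] [NormedSpace ℝ W] [IsScalarTower ℝ 𝕜 W]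
    {p n : ℕ} {M : Type*} [TopologicalSpace M] [ChartedSpace (EuclideanSpace ℝ (Fin n)) M]
    [IsManifold (𝓡 n) ∞ M] [RiemannianBundle (fun x : M => TangentSpace (𝓡 n) x)]
    [IsContMDiffRiemannianBundle (𝓡 n) ∞ (EuclideanSpace ℝ (Fin n))
      (fun x : M => TangentSpace (𝓡 n) x)]
    (f : M → Grassmann.Gr 𝕜 W p) (hf : ContMDiff (𝓡 n) 𝓘(ℝ, Grassmann.Model 𝕜 W p) ∞ f) :
    -- the equivalence of the two conditions
    ((Grassmann.IsHarmonic (EuclideanSpace ℝ (Fin n)) (Grassmann.Model 𝕜 W p) f ∧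
        ∃ h : M → ℝ, Grassmann.HasMeanCurvature (EuclideanSpace ℝ (Fin n)) f (fun x => (h x : 𝕜))) ↔
      ∃ h : M → ℝ, Grassmann.SatisfiesLaplace (EuclideanSpace ℝ (Fin n)) f (fun x => (h x : 𝕜))) ∧
    -- the equivalence with the same function `h`, and the energy density
    (∀ h : M → 𝕜,
      ((Grassmann.IsHarmonic (EuclideanSpace ℝ (Fin n)) (Grassmann.Model 𝕜 W p) f ∧
          Grassmann.HasMeanCurvature (EuclideanSpace ℝ (Fin n)) f h) ↔
        Grassmann.SatisfiesLaplace (EuclideanSpace ℝ (Fin n)) f h) ∧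
      (Grassmann.SatisfiesLaplace (EuclideanSpace ℝ (Fin n)) f h → ∀ x : M,
        (Grassmann.energyDensity (EuclideanSpace ℝ (Fin n)) (Grassmann.Model 𝕜 W p) f x : 𝕜) =
          (Module.finrank 𝕜 (Grassmann.pullQuot f x) : 𝕜) * h x)) ∧
    -- the isometric case
    (Grassmann.IsIsometricImmersion (EuclideanSpace ℝ (Fin n)) (Grassmann.Model 𝕜 W p) f →
      ∀ h : M → 𝕜, Grassmann.SatisfiesLaplace (EuclideanSpace ℝ (Fin n)) f h → ∀ x : M,
        (n : 𝕜) = (Module.finrank 𝕜 (Grassmann.pullQuot f x) : 𝕜) * h x) := by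
  have hf' : ContMDiff (𝓡 n) 𝓘(ℝ, Grassmann.Model 𝕜 W p) 2 f := hf.of_le (by norm_cast)
  have : IsManifold (𝓡 n) 1 M := IsManifold.of_le (n := ∞) (by simp)
  have key := Grassmann.harmonic_and_hasMeanCurvature_iff hf'
  have energy : ∀ h : M → 𝕜, Grassmann.SatisfiesLaplace (EuclideanSpace ℝ (Fin n)) f h → ∀ x : M,
      (Grassmann.energyDensity (EuclideanSpace ℝ (Fin n)) (Grassmann.Model 𝕜 W p) f x : 𝕜) =
        (Module.finrank 𝕜 (Grassmann.pullQuot f x) : 𝕜) * h x :=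
    fun h hh x => Grassmann.energyDensity_eq hf' ((key h).2 hh).2 x
  refine ⟨⟨?_, ?_⟩, fun h => ⟨key h, energy h⟩, fun hi h hh x => ?_⟩
  · rintro ⟨h1, h, h2⟩
    exact ⟨h, (key _).1 ⟨h1, h2⟩⟩
  · rintro ⟨h, h1⟩
    exact ⟨((key _).2 h1).1, h, ((key _).2 h1).2⟩
  · rw [← energy h hh x, Grassmann.energyDensity_of_isIsometricImmersion hi,
      finrank_euclideanSpace_fin, RCLike.ofReal_natCast]
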